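/- Let $(M,\langle\,,\rangle)$ be a $3$-dimensional Riemannian manifold with Levi-Civita connection $\nabla$, and let $\Sigma\subset M$ be an oriented (immersed) surface with unit normal field $\mathcal N$, induced metric $g^\Sigma$, Levi-Civita connection $\nabla^\Sigma$ of $g^\Sigma$, and shape operator $A(X)=-\nabla_X\mathcal N$. Suppose that $\Sigma$ is a prescribed angle (PA) surface with $(\mathcal V,\theta)$: $\mathcal V$ is a smooth unit vector field of $M$ defined along $\Sigma$, $\theta:\Sigma\to[0,\pi/2]$ is smooth, and $\langle\mathcal V,\mathcal N\rangle=\cos\theta$. Suppose that $\mathcal V$ is anti-torqued along $\Sigma$ with smooth potential function $f:\Sigma\to\mathbb R$, that is, $\nabla_X\mathcal V=f\,(X-\langle X,\mathcal V\rangle\mathcal V)$ for every $X$ tangent to $\Sigma$. Let $\{e_1,e_2\}$ be a smooth orthonormal frame of principal directions on an open set $U\subset\Sigma$ on which $\theta$ has no zero, with principal curvatures $\kappa_1,\kappa_2$ (so $A(e_i)=\kappa_ie_i$), such that the component $\mathcal T$ of $\mathcal V$ tangent to $\Sigma$ is $\mathcal T=\sin\theta\, e_1$ on $U$. Put $B=\dfrac{f+\kappa_2\cos\theta}{\sin\theta}$,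 a function which is then smooth on $U$. Then the following hold. (i) On $U$: $e_1(\theta)=\kappa_1+f\cos\theta$ and $e_2(\theta)=0$. (ii) On $U$: $\nabla^\Sigma_{e_1}e_1=\nabla^\Sigma_{e_1}e_2=0$, $\nabla^\Sigma_{e_2}e_1=Be_2$, $\nabla^\Sigma_{e_2}e_2=-Be_1$, and $[e_1,e_2]=-Be_2$. Moreover, around every point of $U$ there are an open neighbourhood contained in $U$, smooth coordinates $(u,v)$ on it with values in an open rectangle $(a,b)\times(c,d)$, a number $u_0\in(a,b)$ and a smooth positive function $p=p(v)$ on $(c,d)$ such that, with $\beta(u,v)=p(v)\exp\Big(\int_{u_0}^{u}B(s,v)\,ds\Big)$, the following hold at every point of the neighbourhood. (iii) $g^\Sigma=du^2+\beta^2dv^2$, $e_1=\partial_u$, and $e_2=\beta^{-1}\partial_v$. (iv) The intrinsic curvature $K_{\mathrm{int}}$ (the sectional curvature of $g^\Sigma$) and the extrinsic curvature $K_{\mathrm{ext}}=\det A$ are $$K_{\mathrm{int}}=-\Big(\frac{\partial B}{\partial u}+B^2\Big),\qquad K_{\mathrm{ext}}=\Big(\frac{\partial\theta}{\partial u}-f\cos\theta\Big)\kappa_2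 .$$ -/

import Mathlib

open Bundle
open scoped Manifold ContDiff

noncomputable section

namespace PASurface

/-! ### The Levi-Civita connection and sectional curvature -/

section Connection

variable {E : Type*} [NormedAddCommGroup E] [NormedSpace ℝ E] [FiniteDimensional ℝ E]
  {H : Type*} [TopologicalSpace H] {I : ModelWithCorners ℝ E H}
  {M : Type*} [TopologicalSpace M] [ChartedSpace H M] [IsManifold I ∞ M]
  [RiemannianBundle (fun x : M => TangentSpace I x)]

/-- `cov` is the Levi-Civita connection of the Riemannian manifold `M`: the unique connection on
`TM` which is compatible with the metric and torsion-free. Here `cov Y x (X x)` is `(∇_X Y)(x)`. -/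
structure IsLeviCivita (cov : CovariantDerivative I E (fun x : M => TangentSpace I x)) : Prop where
  metric : ∀ (x : M) (a : TangentSpace I x) (Y Z : (x : M) → TangentSpace I x),
    MDifferentiableAt I I.tangent (fun y => (⟨y, Y y⟩ : TangentBundle I M)) x →
    MDifferentiableAt I I.tangent (fun y => (⟨y, Z y⟩ : TangentBundle I M)) x →
    mvfderiv I (fun y => inner ℝ (Y y) (Z y)) x a =
      inner ℝ (cov Y x a) (Z x) + inner ℝ (Y x) (cov Z x a)
  torsion_free : cov.torsion = 0

/-- `R(X, Y)Z = ∇_X ∇_Y Z - ∇_Y ∇_X Z - ∇_{[X, Y]} Z`, for vector fields `X`, `Y`, `Z`. -/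
def curvatureField (cov : CovariantDerivative I E (fun x : M => TangentSpace I x))
    (X Y Z : (x : M) → TangentSpace I x) (x : M) : TangentSpace I x :=
  cov (fun y => cov Z y (Y y)) x (X x) - cov (fun y => cov Z y (X y)) x (Y x)
    - cov Z x (VectorField.mlieBracket I X Y x)

/-- The curvature tensor `R(a, b)c` on tangent vectors at `x`. By tensoriality it may be computed
on any vector fields extending `a`, `b`, `c` smoothly near `x`; we use the fields which are
constant in the preferred trivialization of `TM` at `x`. -/
def curvatureTensor (cov : CovariantDerivative I E (fun x : M => TangentSpace I x)) (x : M)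
    (a b c : TangentSpace I x) : TangentSpace I x :=
  curvatureField cov (FiberBundle.extend E a) (FiberBundle.extend E b) (FiberBundle.extend E c) x

/-- The sectional curvature `⟨R(a, b)b, a⟩ / (⟨a, a⟩⟨b, b⟩ - ⟨a, b⟩²)` of the plane spanned by
the linearly independent tangent vectors `a`, `b` at `x`. -/
def sectionalCurvature (cov : CovariantDerivative I E (fun x : M => TangentSpace I x)) (x : M)
    (a b : TangentSpace I x) : ℝ :=
  inner ℝ (curvatureTensor cov x a b b) a / (inner ℝ a a * inner ℝ b b - inner ℝ a b ^ 2)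

end Connection

/-! ### Hypersurfaces and vector fields along them -/

section Hypersurface

variable {E : Type*} [NormedAddCommGroup E] [NormedSpace ℝ E] [FiniteDimensional ℝ E]
  {H : Type*} [TopologicalSpace H] {I : ModelWithCorners ℝ E H}
  {M : Type*} [TopologicalSpace M] [ChartedSpace H M] [IsManifold I ∞ M]
  {E' : Type*} [NormedAddCommGroup E'] [NormedSpace ℝ E'] [FiniteDimensional ℝ E']
  {H' : Type*} [TopologicalSpace H'] {J : ModelWithCorners ℝ E' H'}
  {S : Type*} [TopologicalSpace S] [ChartedSpace H' S] [IsManifold J ∞ S]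

/-- The covariant derivative `∇_X W` at `x`, for `X ∈ T_x S`, of a vector field `W` along a map
`F : S → M`, induced by a connection `cov` on `TM`. Near `F x` the preferred trivialization of `TM`
at `F x` gives a frame `(s_i)`; if `W = ∑ Wⁱ (s_i ∘ F)` then
`∇_X W = ∑ (dWⁱ(X) s_i + Wⁱ ∇_{dF(X)} s_i)`. -/
def covAlong (cov : CovariantDerivative I E (fun y : M => TangentSpace I y)) (F : S → M)
    (W : (x : S) → TangentSpace I (F x)) (x : S) : TangentSpace J x →L[ℝ] TangentSpace I (F x) :=
  (trivializationAt E (TangentSpace I) (F x)).symmL ℝ (F x) ∘L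
      mvfderiv J (fun q : S => (trivializationAt E (TangentSpace I) (F x)
        (TotalSpace.mk' E (F q) (W q))).2) x
    + cov (FiberBundle.extend E (W x)) (F x) ∘L mfderiv J I F x

variable [RiemannianBundle (fun y : M => TangentSpace I y)]
  [RiemannianBundle (fun x : S => TangentSpace J x)]

variable (I J) in
/-- The linear map `dF_x : T_x S → T_{F x} M`. -/
def tangentMapAt (F : S → M) (x : S) :
    TangentSpace J x →ₗ[ℝ] TangentSpace I (F x) :=
  (mfderiv J I F x).toLinearMap

instance (x : S) : FiniteDimensional ℝ (TangentSpace J x) :=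
  inferInstanceAs (FiniteDimensional ℝ E')

variable (I J) in
/-- `S` with its unit normal field `N` is an oriented hypersurface of `M`, immersed by `F`, and the
metric of `S` is the induced one. -/
structure IsHypersurface (F : S → M)
    (N : (x : S) → TangentSpace I (F x)) : Prop where
  codim : Module.finrank ℝ E = Module.finrank ℝ E' + 1
  smooth : ContMDiff J I ∞ F
  isometric : ∀ (x : S) (a b : TangentSpace J x),
    inner ℝ (tangentMapAt I J F x a) (tangentMapAt I J F x b) = inner ℝ a b
  normal_smooth : ContMDiff J I.tangent ∞ (fun x : S => (⟨F x, N x⟩ : TangentBundle I M))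
  normal_unit : ∀ x : S, ‖N x‖ = 1
  normal_orthogonal : ∀ (x : S) (a : TangentSpace J x), inner ℝ (N x) (tangentMapAt I J F x a) = 0

variable (I J) in
/-- The tangential part in `T_x S` of a vector `w ∈ T_{F x} M`. As `dF_x` is isometric, its adjoint
is the orthogonal projection onto `dF_x (T_x S)` followed by the inverse of `dF_x`. -/
def tangentialPart (F : S → M) (x : S) :
    TangentSpace I (F x) →ₗ[ℝ] TangentSpace J x :=
  LinearMap.adjoint (tangentMapAt I J F x)

/-- The shape operator `A(X) = -∇_X N`, as an endomorphism of `T_x S` (`∇_X N` is tangent to the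
hypersurface because `N` has unit length). -/
def shapeOperator (cov : CovariantDerivative I E (fun y : M => TangentSpace I y)) (F : S → M)
    (N : (x : S) → TangentSpace I (F x)) (x : S) : TangentSpace J x →ₗ[ℝ] TangentSpace J x :=
  -(tangentialPart I J F x ∘ₗ (covAlong (J := J) cov F N x).toLinearMap)

variable (I J) in
/-- The hypersurface is a prescribed angle hypersurface with `(V, θ)`: `V` is a smooth unit vector
field along it, `θ` is smooth with values in `[0, π/2]`, and `⟨V, N⟩ = cos θ`. -/
structure IsPrescribedAngle (F : S → M)
    (N V : (x : S) → TangentSpace I (F x)) (θ : S → ℝ) : Prop extends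
    IsHypersurface I J F N where
  field_smooth : ContMDiff J I.tangent ∞ (fun x : S => (⟨F x, V x⟩ : TangentBundle I M))
  field_unit : ∀ x : S, ‖V x‖ = 1
  angle_smooth : ContMDiff J 𝓘(ℝ, ℝ) ∞ θ
  angle_mem : ∀ x : S, θ x ∈ Set.Icc 0 (Real.pi / 2)
  inner_normal : ∀ x : S, inner ℝ (V x) (N x) = Real.cos (θ x)

variable (J) in
/-- `V` is anti-torqued along the hypersurface, with potential function `f`:
`∇_X V = f (X - ⟨X, V⟩ V)` for `X` tangent to the hypersurface. -/
structure IsAntiTorquedAlong (cov : CovariantDerivative I E (fun y : M => TangentSpace I y)) (F : S → M)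
    (V : (x : S) → TangentSpace I (F x)) (f : S → ℝ) : Prop where
  potential_smooth : ContMDiff J 𝓘(ℝ, ℝ) ∞ f
  cov_eq : ∀ (x : S) (a : TangentSpace J x), covAlong (J := J) cov F V x a =
    f x • (tangentMapAt I J F x a - inner ℝ (tangentMapAt I J F x a) (V x) • V x)

end Hypersurface

/-! ### Coordinates on a surface -/

section Coordinates

variable {S : Type*} [TopologicalSpace S] [ChartedSpace (EuclideanSpace ℝ (Fin 2)) S]

/-- The coordinate vector field `∂_i` of the chart `φ`, at the point with coordinates `z`. -/
def coordField (φ : OpenPartialHomeomorph S (EuclideanSpace ℝ (Fin 2))) (i : Fin 2)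
    (z : EuclideanSpace ℝ (Fin 2)) : TangentSpace (𝓡 2) (φ.symm z) :=
  mfderiv (𝓡 2) (𝓡 2) φ.symm z (EuclideanSpace.single i (1 : ℝ))

/-- The differential at `x` of the `i`-th coordinate function of the chart `φ`. -/
def coordDiff (φ : OpenPartialHomeomorph S (EuclideanSpace ℝ (Fin 2))) (i : Fin 2) (x : S) :
    TangentSpace (𝓡 2) x →L[ℝ] ℝ :=
  mvfderiv (𝓡 2) (fun q : S => φ q i) x

/-- The partial derivative `∂h/∂u`, in the coordinates `(u, v)` of the chart `φ`, of a function `h`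
on the surface, at the point with coordinates `z`. -/
def partialU (φ : OpenPartialHomeomorph S (EuclideanSpace ℝ (Fin 2))) (h : S → ℝ)
    (z : EuclideanSpace ℝ (Fin 2)) : ℝ :=
  deriv (fun s : ℝ => h (φ.symm !₂[s, z 1])) (z 0)

end Coordinates

end PASurface

end

/-! The geometry of the surface is governed by the single identity $[e_1,e_2]=-Be_2$. Since
$\mathcal V=\sin\theta\,dF(e_1)+\cos\theta\,\mathcal N$, differentiating $\langle\mathcal V,\mathcal
N\rangle=\cos\theta$ in a tangent direction $a$ gives
$-\sin\theta\,d\theta(a)=-f\sin\theta\cos\theta\langle a,e_1\rangle-\sin\theta\langle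
Aa,e_1\rangle$, and dividing by $-\sin\theta$ yields (i); this is `mvfderiv_angle`. Differentiating
$\langle\mathcal V,dF(e_2)\rangle=0$ and $\langle\mathcal N,dF(e_2)\rangle=0$ gives in the same way
the $dF(e_1)$-component of $\nabla_a\,dF(e_2)$ (`inner_covAlong_frame`). Torsion-freeness of the
ambient connection, pulled back to $\nabla_X dF(Y)-\nabla_Y dF(X)=dF[X,Y]$ (`covAlong_mfderiv_sub`),
turns this into the bracket (`mlieBracket_frame`).

From there on the argument for (ii) and $K_{\mathrm{int}}$ is intrinsic: the brackets of an
orthonormal frame determine its Levi-Civita connection, hence $\nabla^\Sigma e_i$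
(`IsLeviCivita.cov_frame`) and $K_{\mathrm{int}}=-(e_1(B)+B^2)$
(`IsLeviCivita.sectionalCurvature_frame`). The connections of $M$ and $\Sigma$ are never compared
through a Gauss formula. The extrinsic curvature is $\kappa_1\kappa_2$ with $\kappa_1$ taken from
(i).

For the coordinates, let $G(u,v)$ follow $e_2$ for time $v$ from the given point and then $e_1$ for
time $u$. Along the integral curves of $e_1$ both $\partial_vG$ and $\beta e_2$, with
$\partial_u\beta=B\beta$, solve the linearised flow equation, the second because of the bracket
identity. They agree at $u=0$, where $\beta=1$, so $\partial_v=\beta e_2$ (`exists_adapted_map`),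
and one may take $p=1$, $u_0=0$. Smoothness of $G$ rests on smooth dependence of flows on the
initial point, obtained from the implicit function theorem on a space of paths
(`exists_smooth_flow_of_contDiff`). -/

namespace PASurface
open VectorField Set
open scoped Topology
universe u

/-! ### Vector fields and Lie brackets read in a chart -/

section
variable {E : Type*} [NormedAddCommGroup E] [NormedSpace ℝ E]
  {M : Type*} [TopologicalSpace M] [ChartedSpace E M]
  {G : Type*} [NormedAddCommGroup G] [NormedSpace ℝ G]

/-- A vector field read in the preferred chart at `x`. -/
noncomputable def chartField (x : M) (X : (y : M) → TangentSpace 𝓘(ℝ, E) y) : E → E :=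
  fun z => mvfderiv 𝓘(ℝ, E) (extChartAt 𝓘(ℝ, E) x) ((extChartAt 𝓘(ℝ, E) x).symm z) (X ((extChartAt 𝓘(ℝ, E) x).symm z))

variable [IsManifold 𝓘(ℝ, E) 1 M]

/-- This links the bundle side to the chart side: the fields `FiberBundle.extend`, used to define
`covAlong` and `curvatureTensor`, thereby become fields with constant coordinates. -/
theorem trivializationAt_apply_snd {x y : M} (hy : y ∈ (chartAt E x).source) (a : TangentSpace 𝓘(ℝ, E) y) :
    (trivializationAt E (TangentSpace 𝓘(ℝ, E)) x (TotalSpace.mk' E y a)).2 =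
      mvfderiv 𝓘(ℝ, E) (extChartAt 𝓘(ℝ, E) x) y a := by
  have h := TangentBundle.continuousLinearMapAt_trivializationAt (𝕜 := ℝ) (I := 𝓘(ℝ, E)) hy
  have h2 := congrArg (fun L => L a) h
  refine Eq.trans ?_ h2
  rw [Trivialization.continuousLinearMapAt_apply, Trivialization.linearMapAt_apply, if_pos]
  simpa using hy

theorem mvfderiv_extChartAt_self (x : M) (a : TangentSpace 𝓘(ℝ, E) x) :
    mvfderiv 𝓘(ℝ, E) (extChartAt 𝓘(ℝ, E) x) x a = a := by
  rw [← trivializationAt_apply_snd (mem_chart_source E x)]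
  have := tangentBundleCore_coordChange_achart (I := 𝓘(ℝ,E)) x x x
  simp only [TangentBundle.trivializationAt_apply]
  exact (tangentBundleCore 𝓘(ℝ, E) M).coordChange_self (achart E x) x (mem_achart_source E x) a

omit [IsManifold 𝓘(ℝ, E) 1 M] in
theorem chartField_apply {x y : M} (hy : y ∈ (chartAt E x).source) (X : (y : M) → TangentSpace 𝓘(ℝ, E) y) :
    chartField x X (extChartAt 𝓘(ℝ, E) x y) = mvfderiv 𝓘(ℝ, E) (extChartAt 𝓘(ℝ, E) x) y (X y) := by
  unfold chartField
  congr! <;> simp [hy]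

theorem mvfderiv_eq_fderiv_extChartAt {h : M → G} {x y : M} (hy : y ∈ (chartAt E x).source)
    (hh : MDifferentiableAt 𝓘(ℝ, E) 𝓘(ℝ, G) h y) (a : TangentSpace 𝓘(ℝ, E) y) :
    mvfderiv 𝓘(ℝ, E) h y a = fderiv ℝ (h ∘ (extChartAt 𝓘(ℝ, E) x).symm) (extChartAt 𝓘(ℝ, E) x y)
      (mvfderiv 𝓘(ℝ, E) (extChartAt 𝓘(ℝ, E) x) y a) := by
  have hy' : y ∈ (extChartAt 𝓘(ℝ, E) x).source := by simpa using hy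
  have e1 : h =ᶠ[𝓝 y] (h ∘ (extChartAt 𝓘(ℝ, E) x).symm) ∘ extChartAt 𝓘(ℝ, E) x := by
    filter_upwards [(isOpen_extChartAt_source x).mem_nhds hy'] with q hq
    simp only [Function.comp_apply]; rw [(extChartAt 𝓘(ℝ, E) x).left_inv hq]
  have h2 : MDifferentiableAt 𝓘(ℝ, E) 𝓘(ℝ, E) (extChartAt 𝓘(ℝ, E) x) y :=
    mdifferentiableAt_extChartAt hy
  have h3 : MDifferentiableAt 𝓘(ℝ, E) 𝓘(ℝ, G) (h ∘ (extChartAt 𝓘(ℝ, E) x).symm) (extChartAt 𝓘(ℝ, E) x y) := by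
    have := mdifferentiableWithinAt_extChartAt_symm (I := 𝓘(ℝ, E)) ((extChartAt 𝓘(ℝ, E) x).map_source hy')
    simp only [modelWithCornersSelf_coe, range_id, mdifferentiableWithinAt_univ] at this
    refine MDifferentiableAt.comp _ ?_ this
    rwa [(extChartAt 𝓘(ℝ, E) x).left_inv hy']
  simp only [mvfderiv]
  rw [e1.mfderiv_eq, mfderiv_comp y h3 h2, mfderiv_eq_fderiv]
  rfl

theorem differentiableAt_chartField [IsManifold 𝓘(ℝ, E) 2 M] {x : M} {X : (y : M) → TangentSpace 𝓘(ℝ, E) y} {y : M} (hy : y ∈ (chartAt E x).source)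
    (hX : MDifferentiableAt 𝓘(ℝ, E) 𝓘(ℝ, E).tangent (fun y => (⟨y, X y⟩ : TangentBundle 𝓘(ℝ, E) M)) y) :
    DifferentiableAt ℝ (chartField x X) (extChartAt 𝓘(ℝ, E) x y) := by
  have hy' : y ∈ (extChartAt 𝓘(ℝ, E) x).source := by simpa using hy
  have h1 := ((trivializationAt E (TangentSpace 𝓘(ℝ, E)) x).mdifferentiableAt_section_iff 𝓘(ℝ, E) X (by simpa using hy)).1 hX
  have h4 := mdifferentiableWithinAt_extChartAt_symm (I := 𝓘(ℝ, E)) ((extChartAt 𝓘(ℝ, E) x).map_source hy')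
  simp only [modelWithCornersSelf_coe, range_id, mdifferentiableWithinAt_univ] at h4
  rw [← mdifferentiableAt_iff_differentiableAt]
  have h5 := MDifferentiableAt.comp (extChartAt 𝓘(ℝ, E) x y) (by rwa [(extChartAt 𝓘(ℝ, E) x).left_inv hy']) h4
  refine h5.congr_of_eventuallyEq ?_
  filter_upwards [(isOpen_extChartAt_target x).mem_nhds ((extChartAt 𝓘(ℝ, E) x).map_source hy')] with z hz
  simp only [Function.comp_apply]
  have hz' := (extChartAt 𝓘(ℝ, E) x).map_target hz
  rw [trivializationAt_apply_snd (by simpa using hz')]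
  rfl

theorem mlieBracket_eq_lieBracket_chartField (x : M) (X Y : (y : M) → TangentSpace 𝓘(ℝ, E) y) :
    mlieBracket 𝓘(ℝ, E) X Y x = lieBracket ℝ (chartField x X) (chartField x Y) (extChartAt 𝓘(ℝ, E) x x) := by
  have key : ∀ (X : (y : M) → TangentSpace 𝓘(ℝ, E) y), (mpullbackWithin 𝓘(ℝ, E) 𝓘(ℝ, E) (extChartAt 𝓘(ℝ, E) x).symm X (range 𝓘(ℝ, E)) : E → E) =ᶠ[𝓝 (extChartAt 𝓘(ℝ, E) x x)] chartField x X := by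
    intro X
    filter_upwards [(isOpen_extChartAt_target x).mem_nhds (mem_extChartAt_target x)] with z hz
    have h1 := mfderiv_extChartAt_comp_mfderivWithin_extChartAt_symm (I := 𝓘(ℝ, E)) hz
    have h2 := mfderivWithin_extChartAt_symm_comp_mfderiv_extChartAt (I := 𝓘(ℝ, E)) hz
    have h3 := ContinuousLinearMap.inverse_eq h2 h1
    rw [mpullbackWithin_apply, h3]
    rfl
  have h1 := Filter.EventuallyEq.lieBracketWithin_vectorField_eq_nhds (𝕜 := ℝ) (s := range 𝓘(ℝ, E)) (key X) (key Y)
  have h2 : (mfderiv 𝓘(ℝ, E) 𝓘(ℝ, E) (extChartAt 𝓘(ℝ, E) x) x).inverse = ContinuousLinearMap.id ℝ E := by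
    have : mfderiv 𝓘(ℝ, E) 𝓘(ℝ, E) (extChartAt 𝓘(ℝ, E) x) x = ContinuousLinearMap.id ℝ E :=
      ContinuousLinearMap.ext fun a => mvfderiv_extChartAt_self x a
    refine (congrArg ContinuousLinearMap.inverse this).trans ?_
    exact ContinuousLinearMap.inverse_id
  simp only [mlieBracket, mlieBracketWithin_apply]
  refine (congrArg (fun L : E →L[ℝ] E => L _) h2).trans ?_
  simp only [preimage_univ, univ_inter]
  refine Eq.trans h1 ?_
  rw [modelWithCornersSelf_coe, range_id, lieBracketWithin_univ]

omit [IsManifold 𝓘(ℝ, E) 1 M] in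
theorem contDiffAt_comp_extChartAt_symm [IsManifold 𝓘(ℝ, E) 2 M] {h : M → G} {x : M}
    (hh : ContMDiffAt 𝓘(ℝ, E) 𝓘(ℝ, G) 2 h x) :
    ContDiffAt ℝ 2 (h ∘ (extChartAt 𝓘(ℝ, E) x).symm) (extChartAt 𝓘(ℝ, E) x x) := by
  have hx' : x ∈ (extChartAt 𝓘(ℝ, E) x).source := mem_extChartAt_source x
  have h4 := contMDiffWithinAt_extChartAt_symm_range (I := 𝓘(ℝ, E)) (n := 2) x
    ((extChartAt 𝓘(ℝ, E) x).map_source hx')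
  simp only [modelWithCornersSelf_coe, range_id, contMDiffWithinAt_univ] at h4
  rw [← contMDiffAt_iff_contDiffAt]
  refine ContMDiffAt.comp _ ?_ h4
  rwa [(extChartAt 𝓘(ℝ, E) x).left_inv hx']

theorem mvfderiv_apply_eventuallyEq [IsManifold 𝓘(ℝ, E) 2 M] {h : M → G} {x : M}
    (hh : ContMDiffAt 𝓘(ℝ, E) 𝓘(ℝ, G) 2 h x) (Z : (y : M) → TangentSpace 𝓘(ℝ, E) y) :
    (fun y => mvfderiv 𝓘(ℝ, E) h y (Z y)) =ᶠ[𝓝 x]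
      (fun z => fderiv ℝ (h ∘ (extChartAt 𝓘(ℝ, E) x).symm) z (chartField x Z z)) ∘ extChartAt 𝓘(ℝ, E) x := by
  filter_upwards [(contMDiffAt_iff_contMDiffAt_nhds (by simp)).1 hh,
    (chartAt E x).open_source.mem_nhds (mem_chart_source E x)] with y hy hys
  rw [mvfderiv_eq_fderiv_extChartAt hys (hy.mdifferentiableAt (by simp)), Function.comp_apply, chartField_apply hys]

theorem mdifferentiableAt_mvfderiv_apply [IsManifold 𝓘(ℝ, E) 2 M] {h : M → G} {x : M}
    {Y : (y : M) → TangentSpace 𝓘(ℝ, E) y} (hh : ContMDiffAt 𝓘(ℝ, E) 𝓘(ℝ, G) 2 h x)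
    (hY : MDifferentiableAt 𝓘(ℝ, E) 𝓘(ℝ, E).tangent (fun y => (⟨y, Y y⟩ : TangentBundle 𝓘(ℝ, E) M)) x) :
    MDifferentiableAt 𝓘(ℝ, E) 𝓘(ℝ, G) (fun y => mvfderiv 𝓘(ℝ, E) h y (Y y)) x := by
  have hx := mem_chart_source E x
  have hd := (((contDiffAt_comp_extChartAt_symm hh).fderiv_right (m := 1) (by norm_num)).differentiableAt
    (by simp)).clm_apply (differentiableAt_chartField hx hY)
  exact (hd.mdifferentiableAt.comp x (mdifferentiableAt_extChartAt hx)).congr_of_eventuallyEq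
    (mvfderiv_apply_eventuallyEq hh Y)

/-- In a chart both iterated derivatives contain the Hessian of `h` on the same pair, so by symmetry
only the derivatives of the fields survive. Vector-valued `h` is allowed because taking `h` to be a
chart, or a chart composed with an immersion, recovers the bracket itself. -/
theorem mvfderiv_mlieBracket [IsManifold 𝓘(ℝ, E) 2 M] {h : M → G} {x : M} {X Y : (y : M) → TangentSpace 𝓘(ℝ, E) y}
    (hh : ContMDiffAt 𝓘(ℝ, E) 𝓘(ℝ, G) 2 h x)
    (hX : MDifferentiableAt 𝓘(ℝ, E) 𝓘(ℝ, E).tangent (fun y => (⟨y, X y⟩ : TangentBundle 𝓘(ℝ, E) M)) x)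
    (hY : MDifferentiableAt 𝓘(ℝ, E) 𝓘(ℝ, E).tangent (fun y => (⟨y, Y y⟩ : TangentBundle 𝓘(ℝ, E) M)) x) :
    mvfderiv 𝓘(ℝ, E) (fun y => mvfderiv 𝓘(ℝ, E) h y (Y y)) x (X x) -
      mvfderiv 𝓘(ℝ, E) (fun y => mvfderiv 𝓘(ℝ, E) h y (X y)) x (Y x) =
      mvfderiv 𝓘(ℝ, E) h x (mlieBracket 𝓘(ℝ, E) X Y x) := by
  set ψ := extChartAt 𝓘(ℝ, E) x with hψ
  have hx := mem_chart_source E x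
  set g : E → G := h ∘ ψ.symm with hg
  have hgc : ContDiffAt ℝ 2 g (ψ x) := contDiffAt_comp_extChartAt_symm hh
  have key : ∀ Z W : (y : M) → TangentSpace 𝓘(ℝ, E) y, DifferentiableAt ℝ (chartField x Z) (ψ x) →
      mvfderiv 𝓘(ℝ, E) (fun y => mvfderiv 𝓘(ℝ, E) h y (Z y)) x (W x) =
      fderiv ℝ (fderiv ℝ g) (ψ x) (chartField x W (ψ x)) (chartField x Z (ψ x)) +
        fderiv ℝ g (ψ x) (fderiv ℝ (chartField x Z) (ψ x) (chartField x W (ψ x))) := by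
    intro Z W hZ
    have e1 := mvfderiv_apply_eventuallyEq hh Z
    have hd : DifferentiableAt ℝ (fun z => fderiv ℝ g z (chartField x Z z)) (ψ x) :=
      (hgc.fderiv_right (m := 1) (by norm_num)).differentiableAt (by simp) |>.clm_apply hZ
    rw [mvfderiv, e1.mfderiv_eq, mfderiv_comp x hd.mdifferentiableAt (mdifferentiableAt_extChartAt hx),
      mfderiv_eq_fderiv, fderiv_clm_apply ((hgc.fderiv_right (m := 1) (by norm_num)).differentiableAt (by simp)) hZ,
      chartField_apply hx Z, chartField_apply hx W, add_comm]
    rfl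
  have hX' := differentiableAt_chartField hx hX
  have hY' := differentiableAt_chartField hx hY
  have hsymm : IsSymmSndFDerivAt ℝ g (ψ x) := hgc.isSymmSndFDerivAt (by simp)
  rw [key _ _ hX', key _ _ hY', hsymm.eq, mvfderiv_eq_fderiv_extChartAt hx (hh.mdifferentiableAt (by simp)),
    mvfderiv_extChartAt_self, mlieBracket_eq_lieBracket_chartField, lieBracket, map_sub]
  abel
end

section
variable {E : Type*} [NormedAddCommGroup E] [NormedSpace ℝ E]
  {M : Type*} [TopologicalSpace M] [ChartedSpace E M] [IsManifold 𝓘(ℝ, E) 2 M]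

theorem mvfderiv_congr {E' H' G S : Type*} [NormedAddCommGroup E'] [NormedSpace ℝ E'] [TopologicalSpace H']
    {J : ModelWithCorners ℝ E' H'} [TopologicalSpace S] [ChartedSpace H' S]
    [NormedAddCommGroup G] [NormedSpace ℝ G] {f g : S → G} {x : S} (h : f =ᶠ[𝓝 x] g) (a : TangentSpace J x) :
    mvfderiv J f x a = mvfderiv J g x a := by
  unfold mvfderiv
  rw [h.mfderiv_eq]
  rfl

/-- The chart has constant derivative along such fields, so both iterated derivatives vanish when
the bracket acts on the chart. -/
theorem mlieBracket_extend [CompleteSpace E] {x : M} (a b : TangentSpace 𝓘(ℝ, E) x) :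
    mlieBracket 𝓘(ℝ, E) (FiberBundle.extend E a) (FiberBundle.extend E b) x = 0 := by
  have : IsManifold 𝓘(ℝ, E) 1 M := IsManifold.of_le (n := 2) (by norm_num)
  have hd : ∀ a : TangentSpace 𝓘(ℝ, E) x, MDifferentiableAt 𝓘(ℝ, E) 𝓘(ℝ, E).tangent
      (fun y => (⟨y, FiberBundle.extend E a y⟩ : TangentBundle 𝓘(ℝ, E) M)) x := fun a =>
    FiberBundle.mdifferentiableAt_extend ..
  have h := mvfderiv_mlieBracket (h := extChartAt 𝓘(ℝ, E) x)
    ((contMDiffAt_extChartAt (I := 𝓘(ℝ, E)) (n := 2))) (hd a) (hd b)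
  have hc : ∀ a c : TangentSpace 𝓘(ℝ, E) x, mvfderiv 𝓘(ℝ, E) (fun y => mvfderiv 𝓘(ℝ, E) (extChartAt 𝓘(ℝ, E) x) y
      (FiberBundle.extend E a y)) x c = 0 := by
    intro a c
    rw [mvfderiv_congr (g := fun _ => (trivializationAt E (TangentSpace 𝓘(ℝ, E)) x ⟨x, a⟩).2)]
    · simp [mvfderiv_const]
    · filter_upwards [(chartAt E x).open_source.mem_nhds (mem_chart_source E x)] with y hy
      rw [← trivializationAt_apply_snd hy, FiberBundle.extend]
      have := (Trivialization.apply_mk_symm (trivializationAt E (TangentSpace 𝓘(ℝ, E)) x) (b := y) (by simpa using hy)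
        (trivializationAt E (TangentSpace 𝓘(ℝ, E)) x ⟨x, a⟩).2)
      exact (congrArg (fun p : M × E => p.2) this :)
  rw [hc, hc, mvfderiv_extChartAt_self] at h
  exact h.symm.trans (sub_zero (0 : E))

/-- One fixed chart must serve at all points of its domain, not only at its centre: this carries the
bracket relation to an open set of the model space, where the flows are built. -/
theorem mvfderiv_extChartAt_mlieBracket [CompleteSpace E] {x y : M} (hy : y ∈ (chartAt E x).source)
    {X Y : (y : M) → TangentSpace 𝓘(ℝ, E) y}
    (hX : MDifferentiableAt 𝓘(ℝ, E) 𝓘(ℝ, E).tangent (fun y => (⟨y, X y⟩ : TangentBundle 𝓘(ℝ, E) M)) y)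
    (hY : MDifferentiableAt 𝓘(ℝ, E) 𝓘(ℝ, E).tangent (fun y => (⟨y, Y y⟩ : TangentBundle 𝓘(ℝ, E) M)) y) :
    lieBracket ℝ (chartField x X) (chartField x Y) (extChartAt 𝓘(ℝ, E) x y) =
      mvfderiv 𝓘(ℝ, E) (extChartAt 𝓘(ℝ, E) x) y (mlieBracket 𝓘(ℝ, E) X Y y) := by
  have : IsManifold 𝓘(ℝ, E) 1 M := IsManifold.of_le (n := 2) (by norm_num)
  have h := mvfderiv_mlieBracket (h := extChartAt 𝓘(ℝ, E) x)
    ((contMDiffAt_extChartAt' (I := 𝓘(ℝ, E)) (n := 2) hy)) hX hY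
  rw [← h]
  have key : ∀ Z W : (y : M) → TangentSpace 𝓘(ℝ, E) y, DifferentiableAt ℝ (chartField x Z) (extChartAt 𝓘(ℝ, E) x y) →
      mvfderiv 𝓘(ℝ, E) (fun y => mvfderiv 𝓘(ℝ, E) (extChartAt 𝓘(ℝ, E) x) y (Z y)) y (W y) =
      fderiv ℝ (chartField x Z) (extChartAt 𝓘(ℝ, E) x y) (chartField x W (extChartAt 𝓘(ℝ, E) x y)) := by
    intro Z W hZ
    rw [mvfderiv_congr (g := chartField x Z ∘ extChartAt 𝓘(ℝ, E) x), chartField_apply hy W]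
    · rw [mvfderiv, mfderiv_comp y hZ.mdifferentiableAt (mdifferentiableAt_extChartAt hy), mfderiv_eq_fderiv]
      rfl
    · filter_upwards [(chartAt E x).open_source.mem_nhds hy] with q hq
      rw [Function.comp_apply, chartField_apply hq]
  rw [key _ _ (differentiableAt_chartField hy hX), key _ _ (differentiableAt_chartField hy hY)]
  rfl
end

/-! ### The covariant derivative along a map -/

section
variable {E : Type*} [NormedAddCommGroup E] [NormedSpace ℝ E] [FiniteDimensional ℝ E]
  {H : Type*} [TopologicalSpace H] {I : ModelWithCorners ℝ E H}
  {M : Type*} [TopologicalSpace M] [ChartedSpace H M] [IsManifold I ∞ M]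
  {E' : Type*} [NormedAddCommGroup E'] [NormedSpace ℝ E']
  {H' : Type*} [TopologicalSpace H'] {J : ModelWithCorners ℝ E' H'}
  {S : Type*} [TopologicalSpace S] [ChartedSpace H' S]

theorem mvfderiv_sum_mul {ι : Type*} (s : Finset ι) {c g : ι → S → ℝ} {x : S}
    (hc : ∀ i ∈ s, MDifferentiableAt J 𝓘(ℝ, ℝ) (c i) x) (hg : ∀ i ∈ s, MDifferentiableAt J 𝓘(ℝ, ℝ) (g i) x)
    (a : TangentSpace J x) :
    MDifferentiableAt J 𝓘(ℝ, ℝ) (fun q => ∑ i ∈ s, c i q * g i q) x ∧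
    mvfderiv J (fun q => ∑ i ∈ s, c i q * g i q) x a =
      ∑ i ∈ s, (c i x * mvfderiv J (g i) x a + g i x * mvfderiv J (c i) x a) := by
  classical
  induction s using Finset.induction_on with
  | empty => simp [mvfderiv_const, mdifferentiableAt_const]
  | insert i s hi ih =>
    have ih' := ih (fun j hj => hc j (by simp [hj])) (fun j hj => hg j (by simp [hj]))
    simp only [Finset.sum_insert hi]
    have hm : MDifferentiableAt J 𝓘(ℝ, ℝ) (fun q => c i q * g i q) x := (hc i (by simp)).mul (hg i (by simp))
    refine ⟨hm.add ih'.1, ?_⟩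
    rw [mvfderiv_fun_add hm ih'.1, add_apply, ih'.2,
      mvfderiv_fun_mul (hc i (by simp)) (hg i (by simp))]
    simp

variable [RiemannianBundle (fun y : M => TangentSpace I y)]
  [IsContMDiffRiemannianBundle I 1 E (fun y : M => TangentSpace I y)]

/-- Half of a product rule. Split `W` near `x` into the field frozen at `W x` and a remainder whose
frame coefficients vanish at `x`. In the derivative of the remainder only the derivatives of those
coefficients count, which is the first term of `covAlong`. -/
theorem mvfderiv_inner_along {F : S → M} {W Z : (x : S) → TangentSpace I (F x)} {x : S}
    (hF : MDifferentiableAt J I F x)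
    (hW : MDifferentiableAt J I.tangent (fun q => (⟨F q, W q⟩ : TangentBundle I M)) x)
    (hZ : MDifferentiableAt J I.tangent (fun q => (⟨F q, Z q⟩ : TangentBundle I M)) x)
    (a : TangentSpace J x) :
    mvfderiv J (fun q => inner ℝ (W q) (Z q)) x a =
      inner ℝ ((trivializationAt E (TangentSpace I) (F x)).symmL ℝ (F x)
        (mvfderiv J (fun q : S => (trivializationAt E (TangentSpace I) (F x) (TotalSpace.mk' E (F q) (W q))).2) x a)) (Z x)
      + mvfderiv J (fun q => inner ℝ (FiberBundle.extend E (W x) (F q)) (Z q)) x a := by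
  set t := trivializationAt E (TangentSpace I : M → Type _) (F x) with ht
  set w : S → E := fun q => (t (TotalSpace.mk' E (F q) (W q))).2 with hw
  have hbase : ∀ᶠ q in 𝓝 x, F q ∈ t.baseSet :=
    hF.continuousAt (t.open_baseSet.mem_nhds (FiberBundle.mem_baseSet_trivializationAt' (F x)))
  have hwd : MDifferentiableAt J 𝓘(ℝ, E) w x := ((mdifferentiableAt_totalSpace _ _).1 hW).2
  let b := Module.finBasis ℝ E
  have hx : F x ∈ t.baseSet := hbase.self_of_nhds
  have hext : ∀ e : E, MDifferentiableAt J I.tangent (fun q => (⟨F q, t.symm (F q) e⟩ : TangentBundle I M)) x := by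
    intro e
    have h1 : MDifferentiableAt I I.tangent (fun y => (⟨y, FiberBundle.extend E (t.symm (F x) e) y⟩ : TangentBundle I M)) (F x) :=
      FiberBundle.mdifferentiableAt_extend ..
    have h2 := h1.comp x hF
    have h3 : (t ⟨F x, t.symm (F x) e⟩).2 = e := congrArg Prod.snd (t.apply_mk_symm hx e)
    simp only [FiberBundle.extend, ← ht, h3] at h2
    exact h2
  have hg : ∀ e : E, MDifferentiableAt J 𝓘(ℝ, ℝ) (fun q => inner ℝ (t.symm (F q) e) (Z q)) x :=
    fun e => MDifferentiableAt.inner_bundle (E := fun y : M => TangentSpace I y) (hext e) hZ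
  have hc : ∀ i, MDifferentiableAt J 𝓘(ℝ, ℝ) (fun q => b.coord i (w q - w x)) x := by
    intro i
    have h1 : MDifferentiableAt J 𝓘(ℝ, E) (fun q => w q - w x) x := hwd.sub mdifferentiableAt_const
    exact (LinearMap.toContinuousLinearMap (b.coord i)).mdifferentiableAt.comp x h1
  have hdc : ∀ i, mvfderiv J (fun q => b.coord i (w q - w x)) x a = b.coord i (mvfderiv J w x a) := by
    intro i
    have h1 : MDifferentiableAt J 𝓘(ℝ, E) (fun q => w q - w x) x := hwd.sub mdifferentiableAt_const
    have h2 : mvfderiv J (fun q => w q - w x) x = mvfderiv J w x := by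
      rw [mvfderiv_fun_sub hwd mdifferentiableAt_const, mvfderiv_const, sub_zero]
    rw [← h2]
    have h3 : MDifferentiableAt 𝓘(ℝ, E) 𝓘(ℝ, ℝ) (LinearMap.toContinuousLinearMap (b.coord i)) (w x - w x) :=
      (LinearMap.toContinuousLinearMap (b.coord i)).mdifferentiableAt
    have h4 := mfderiv_comp x h3 h1
    have h5 : mfderiv 𝓘(ℝ, E) 𝓘(ℝ, ℝ) (LinearMap.toContinuousLinearMap (b.coord i)) (w x - w x) =
      LinearMap.toContinuousLinearMap (b.coord i) := ContinuousLinearMap.mfderiv_eq _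
    have h6 := congrArg (fun L => L a) h4
    refine Eq.trans h6 ?_
    exact congrArg (fun L : E →L[ℝ] ℝ => L (mvfderiv J (fun q => w q - w x) x a)) h5
  have hlin : ∀ q, F q ∈ t.baseSet → ∀ e : E, t.symm (F q) e = ∑ i, b.coord i e • t.symm (F q) (b i) := by
    intro q hq e
    conv_lhs => rw [← b.sum_repr e]
    rw [← t.symmL_apply (R := ℝ) hq]
    have := map_sum (t.symmL ℝ (F q)) (fun i => b.repr e i • b i) Finset.univ
    rw [this]
    refine Finset.sum_congr rfl fun i _ => ?_
    rw [map_smul, t.symmL_apply (R := ℝ) hq]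
    rfl
  have hWq : ∀ᶠ q in 𝓝 x, inner ℝ (W q) (Z q) = ∑ i, b.coord i (w q - w x) * inner ℝ (t.symm (F q) (b i)) (Z q)
      + inner ℝ (FiberBundle.extend E (W x) (F q)) (Z q) := by
    filter_upwards [hbase] with q hq
    have h1 : W q = t.symm (F q) (w q - w x) + FiberBundle.extend E (W x) (F q) := by
      have h2 : W q = t.symm (F q) (w q) := (t.symm_apply_apply_mk hq (W q)).symm
      have := map_sub (t.symmL ℝ (F q)) (w q) (w x)
      simp only [t.symmL_apply (R := ℝ) hq] at this
      rw [this, ← h2]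
      simp [FiberBundle.extend, hw, ht]
    rw [h1, inner_add_left, hlin q hq, sum_inner]
    simp [inner_smul_left]
  have hs := mvfderiv_sum_mul Finset.univ (fun i _ => hc i) (fun i _ => hg (b i)) a
  have h0 : MDifferentiableAt J 𝓘(ℝ, ℝ) (fun q => inner ℝ (FiberBundle.extend E (W x) (F q)) (Z q)) x := hg _
  rw [mvfderiv_congr hWq, mvfderiv_fun_add hs.1 h0, add_apply, hs.2]
  congr 1
  -- The coefficients vanish at `x`, so the terms that differentiate the frame or the metric
  -- disappear.
  simp only [sub_self, map_zero, zero_mul, zero_add, hdc]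
  refine Eq.trans ?_ (congrArg (fun v : TangentSpace I (F x) => inner ℝ v (Z x))
    (t.symmL_apply (R := ℝ) hx (mvfderiv J w x a)).symm)
  rw [hlin x hx, sum_inner]
  refine Finset.sum_congr rfl fun i _ => ?_
  rw [inner_smul_left, mul_comm]
  rfl


/-- Freezing first `W` and then `Z` reduces the claim to the inner product of two frozen fields on
`M`, pulled back by `F`; there the chain rule and metric compatibility of `cov` apply. -/
theorem covAlong_metric {cov : CovariantDerivative I E (fun y : M => TangentSpace I y)} (hcov : IsLeviCivita cov)
    {F : S → M} {W Z : (x : S) → TangentSpace I (F x)} {x : S}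
    (hF : MDifferentiableAt J I F x)
    (hW : MDifferentiableAt J I.tangent (fun q => (⟨F q, W q⟩ : TangentBundle I M)) x)
    (hZ : MDifferentiableAt J I.tangent (fun q => (⟨F q, Z q⟩ : TangentBundle I M)) x)
    (a : TangentSpace J x) :
    mvfderiv J (fun q => inner ℝ (W q) (Z q)) x a =
      inner ℝ (covAlong (J := J) cov F W x a) (Z x) + inner ℝ (W x) (covAlong (J := J) cov F Z x a) := by
  have hd : ∀ v : TangentSpace I (F x), MDifferentiableAt I I.tangent
      (fun y => (⟨y, FiberBundle.extend E v y⟩ : TangentBundle I M)) (F x) := fun v =>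
    FiberBundle.mdifferentiableAt_extend ..
  have hd' := fun v => (hd v).comp x hF
  rw [mvfderiv_inner_along hF hW hZ]
  have h1 : mvfderiv J (fun q => inner ℝ (FiberBundle.extend E (W x) (F q)) (Z q)) x a =
      mvfderiv J (fun q => inner ℝ (Z q) (FiberBundle.extend E (W x) (F q))) x a := by
    simp only [real_inner_comm]
  rw [h1, mvfderiv_inner_along hF hZ (hd' _)]
  have h2 := hcov.metric (F x) (mfderiv J I F x a) _ _ (hd (Z x)) (hd (W x))
  have h3 : mvfderiv J (fun q => inner ℝ (FiberBundle.extend E (Z x) (F q)) (FiberBundle.extend E (W x) (F q))) x a =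
      mvfderiv I (fun y => inner ℝ (FiberBundle.extend E (Z x) y) (FiberBundle.extend E (W x) y)) (F x) (mfderiv J I F x a) := by
    exact mvfderiv_comp_apply (g := fun y => inner ℝ (FiberBundle.extend E (Z x) y) (FiberBundle.extend E (W x) y)) x (MDifferentiableAt.inner_bundle (E := fun y : M => TangentSpace I y) (hd _) (hd _)) hF a
  rw [h3, h2]
  simp only [covAlong, add_apply, ContinuousLinearMap.comp_apply, inner_add_left, inner_add_right,
    FiberBundle.extend_apply_self]
  rw [real_inner_comm (W x), real_inner_comm (W x), real_inner_comm _ (Z x)]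
  ring
end

section
variable {E : Type*} [NormedAddCommGroup E] [NormedSpace ℝ E] [FiniteDimensional ℝ E]
  {M : Type*} [TopologicalSpace M] [ChartedSpace E M] [IsManifold 𝓘(ℝ, E) ∞ M]
  [RiemannianBundle (fun y : M => TangentSpace 𝓘(ℝ, E) y)]
  {E' : Type*} [NormedAddCommGroup E'] [NormedSpace ℝ E']
  {S : Type*} [TopologicalSpace S] [ChartedSpace E' S] [IsManifold 𝓘(ℝ, E') ∞ S]

/-- In the chart at `F x` the derivative parts of the two terms differ by the bracket acting on the
coordinates of `F`. The connection parts cancel by torsion-freeness, because frozen fields have zero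
bracket at `F x`. -/
theorem covAlong_mfderiv_sub {cov : CovariantDerivative 𝓘(ℝ, E) E (fun y : M => TangentSpace 𝓘(ℝ, E) y)}
    (hcov : IsLeviCivita cov) {F : S → M} {x : S} {X Y : (q : S) → TangentSpace 𝓘(ℝ, E') q}
    (hF : ContMDiff 𝓘(ℝ, E') 𝓘(ℝ, E) ∞ F)
    (hX : MDifferentiableAt 𝓘(ℝ, E') 𝓘(ℝ, E').tangent (fun q => (⟨q, X q⟩ : TangentBundle 𝓘(ℝ, E') S)) x)
    (hY : MDifferentiableAt 𝓘(ℝ, E') 𝓘(ℝ, E').tangent (fun q => (⟨q, Y q⟩ : TangentBundle 𝓘(ℝ, E') S)) x) :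
    covAlong (J := 𝓘(ℝ, E')) cov F (fun q => mfderiv 𝓘(ℝ, E') 𝓘(ℝ, E) F q (Y q)) x (X x) -
      covAlong (J := 𝓘(ℝ, E')) cov F (fun q => mfderiv 𝓘(ℝ, E') 𝓘(ℝ, E) F q (X q)) x (Y x) =
    mfderiv 𝓘(ℝ, E') 𝓘(ℝ, E) F x (mlieBracket 𝓘(ℝ, E') X Y x) := by
  set ψ := extChartAt 𝓘(ℝ, E) (F x) with hψ
  have : CompleteSpace E := FiniteDimensional.complete ℝ E
  have hFd : ∀ q, MDifferentiableAt 𝓘(ℝ, E') 𝓘(ℝ, E) F q := fun q => hF.contMDiffAt.mdifferentiableAt (by simp)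
  have hbase : ∀ᶠ q in 𝓝 x, F q ∈ (chartAt E (F x)).source :=
    (hFd x).continuousAt ((chartAt E (F x)).open_source.mem_nhds (mem_chart_source E (F x)))
  have hw : ∀ Z : (q : S) → TangentSpace 𝓘(ℝ, E') q, ∀ᶠ q in 𝓝 x,
      (trivializationAt E (TangentSpace 𝓘(ℝ, E)) (F x) (TotalSpace.mk' E (F q) (mfderiv 𝓘(ℝ, E') 𝓘(ℝ, E) F q (Z q)))).2 = mvfderiv 𝓘(ℝ, E') (ψ ∘ F) q (Z q) := by
    intro Z
    filter_upwards [hbase] with q hq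
    rw [trivializationAt_apply_snd hq, mvfderiv, mvfderiv,
      mfderiv_comp q (mdifferentiableAt_extChartAt hq) (hFd q)]
    rfl
  have hB := mvfderiv_mlieBracket (h := ψ ∘ F) (x := x) (X := X) (Y := Y)
    (ContMDiffAt.comp x (contMDiffAt_extChartAt (n := 2)) (hF.contMDiffAt.of_le ENat.LEInfty.out))
    hX hY
  have hT := (CovariantDerivative.torsion_eq_zero_iff cov).1 hcov.torsion_free
    (FiberBundle.mdifferentiableAt_extend 𝓘(ℝ, E) E (mfderiv 𝓘(ℝ, E') 𝓘(ℝ, E) F x (X x)))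
    (FiberBundle.mdifferentiableAt_extend 𝓘(ℝ, E) E (mfderiv 𝓘(ℝ, E') 𝓘(ℝ, E) F x (Y x)))
  rw [mlieBracket_extend, FiberBundle.extend_apply_self, FiberBundle.extend_apply_self] at hT
  have hx := FiberBundle.mem_baseSet_trivializationAt' (F := E) (E := fun y : M => TangentSpace 𝓘(ℝ, E) y) (F x)
  have hself : (trivializationAt E (TangentSpace 𝓘(ℝ, E)) (F x)).symmL ℝ (F x) (mvfderiv 𝓘(ℝ, E') (ψ ∘ F) x (mlieBracket 𝓘(ℝ, E') X Y x)) =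
      mfderiv 𝓘(ℝ, E') 𝓘(ℝ, E) F x (mlieBracket 𝓘(ℝ, E') X Y x) := by
    rw [← (hw _).self_of_nhds, Trivialization.symmL_apply (R := ℝ) _ hx]
    exact Trivialization.symm_apply_apply_mk _ hx _
  simp only [covAlong, add_apply, ContinuousLinearMap.comp_apply]
  rw [mvfderiv_congr (hw Y), mvfderiv_congr (hw X), add_sub_add_comm, ← map_sub, hB, hT, hself, add_zero]
end

/-! ### Orthonormal pairs, hypersurfaces and the prescribed angle condition -/

theorem eq_smul_add_smul_of_orthonormal {V : Type*} [NormedAddCommGroup V] [InnerProductSpace ℝ V]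
    (hV : Module.finrank ℝ V = 2) {e₁ e₂ : V} (h₁ : ‖e₁‖ = 1) (h₂ : ‖e₂‖ = 1) (h₁₂ : inner ℝ e₁ e₂ = 0) (z : V) :
    z = (inner ℝ z e₁) • e₁ + (inner ℝ z e₂) • e₂ := by
  have ho : Orthonormal ℝ ![e₁, e₂] := by
    rw [orthonormal_iff_ite]
    intro i j
    fin_cases i <;> fin_cases j <;> simp [h₁, h₂, h₁₂, real_inner_comm]
  have : FiniteDimensional ℝ V := FiniteDimensional.of_finrank_pos (by omega)
  have hs : Submodule.span ℝ (Set.range ![e₁, e₂]) = ⊤ :=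
    ho.linearIndependent.span_eq_top_of_card_eq_finrank (by simp [hV])
  let b := OrthonormalBasis.mk ho hs.ge
  have := b.sum_repr' z
  simp only [Fin.sum_univ_two, b, OrthonormalBasis.coe_mk] at this
  conv_lhs => rw [← this]
  simp [real_inner_comm]

section
variable {E : Type*} [NormedAddCommGroup E] [NormedSpace ℝ E] [FiniteDimensional ℝ E]
  {M : Type*} [TopologicalSpace M] [ChartedSpace E M] [IsManifold 𝓘(ℝ, E) ∞ M]
  [RiemannianBundle (fun y : M => TangentSpace 𝓘(ℝ, E) y)]
  {E' : Type*} [NormedAddCommGroup E'] [NormedSpace ℝ E'] [FiniteDimensional ℝ E']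
  {S : Type*} [TopologicalSpace S] [ChartedSpace E' S] [IsManifold 𝓘(ℝ, E') ∞ S]
  [RiemannianBundle (fun y : S => TangentSpace 𝓘(ℝ, E') y)]

theorem inner_tangentialPart (F : S → M) (x : S) (w : TangentSpace 𝓘(ℝ, E) (F x)) (a : TangentSpace 𝓘(ℝ, E') x) :
    inner ℝ (tangentialPart 𝓘(ℝ, E) 𝓘(ℝ, E') F x w) a = inner ℝ w (mfderiv 𝓘(ℝ, E') 𝓘(ℝ, E) F x a) :=
  LinearMap.adjoint_inner_left (tangentMapAt 𝓘(ℝ, E) 𝓘(ℝ, E') F x) a w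

theorem inner_shapeOperator (cov : CovariantDerivative 𝓘(ℝ, E) E (fun y : M => TangentSpace 𝓘(ℝ, E) y)) (F : S → M)
    (N : (x : S) → TangentSpace 𝓘(ℝ, E) (F x)) (x : S) (a b : TangentSpace 𝓘(ℝ, E') x) :
    inner ℝ (shapeOperator cov F N x a) b =
      -inner ℝ (covAlong (J := 𝓘(ℝ, E')) cov F N x a) (mfderiv 𝓘(ℝ, E') 𝓘(ℝ, E) F x b) := by
  rw [← inner_tangentialPart, ← inner_neg_left]
  rfl

/-- The map `(c, a) ↦ c N + dF(a)` is injective, since `N` is a unit normal and `dF` is isometric.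
By the codimension it is then onto, so `w` is orthogonal to everything, itself included. -/
theorem IsHypersurface.eq_zero {F : S → M} {N : (x : S) → TangentSpace 𝓘(ℝ, E) (F x)}
    (h : IsHypersurface 𝓘(ℝ, E) 𝓘(ℝ, E') F N) {x : S} {w : TangentSpace 𝓘(ℝ, E) (F x)}
    (hN : inner ℝ w (N x) = 0) (ht : ∀ a : TangentSpace 𝓘(ℝ, E') x, inner ℝ w (mfderiv 𝓘(ℝ, E') 𝓘(ℝ, E) F x a) = 0) : w = 0 := by
  let L : (ℝ × TangentSpace 𝓘(ℝ, E') x) →ₗ[ℝ] TangentSpace 𝓘(ℝ, E) (F x) :=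
    (LinearMap.toSpanSingleton ℝ _ (N x)).coprod (tangentMapAt 𝓘(ℝ, E) 𝓘(ℝ, E') F x)
  have hL : ∀ p, L p = p.1 • N x + tangentMapAt 𝓘(ℝ, E) 𝓘(ℝ, E') F x p.2 := fun p => by simp [L]
  have hinj : Function.Injective L := by
    rw [← LinearMap.ker_eq_bot, LinearMap.ker_eq_bot']
    rintro ⟨c, a⟩ h0
    rw [hL] at h0
    have h1 : inner ℝ (N x) (c • N x + tangentMapAt 𝓘(ℝ, E) 𝓘(ℝ, E') F x a) = c := by
      rw [inner_add_right, h.normal_orthogonal, inner_smul_right, real_inner_self_eq_norm_sq, h.normal_unit]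
      simp
    have hc : c = 0 := by rw [← h1]; simp only at h0; rw [h0, inner_zero_right]
    have h2 : tangentMapAt 𝓘(ℝ, E) 𝓘(ℝ, E') F x a = 0 := by simpa [hc] using h0
    have h3 := h.isometric x a a
    rw [h2, inner_zero_left] at h3
    have : a = 0 := inner_self_eq_zero.1 h3.symm
    simp [hc, this]
  have hfr : Module.finrank ℝ (ℝ × TangentSpace 𝓘(ℝ, E') x) = Module.finrank ℝ (TangentSpace 𝓘(ℝ, E) (F x)) := by
    rw [Module.finrank_prod]
    have := h.codim
    change _ + Module.finrank ℝ E' = Module.finrank ℝ E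
    rw [this, Module.finrank_self, add_comm]
  obtain ⟨p, hp⟩ := (LinearMap.injective_iff_surjective_of_finrank_eq_finrank hfr).1 hinj w
  rw [← inner_self_eq_zero (𝕜 := ℝ)]
  nth_rw 2 [← hp]
  rw [hL, inner_add_right, inner_smul_right, hN, mul_zero, zero_add]
  exact ht p.2
end

section
variable {E : Type*} [NormedAddCommGroup E] [NormedSpace ℝ E] [FiniteDimensional ℝ E]
  {M : Type*} [TopologicalSpace M] [ChartedSpace E M] [IsManifold 𝓘(ℝ, E) ∞ M]
  [RiemannianBundle (fun y : M => TangentSpace 𝓘(ℝ, E) y)]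
  [IsContMDiffRiemannianBundle 𝓘(ℝ, E) ∞ E (fun y : M => TangentSpace 𝓘(ℝ, E) y)]
  {E' : Type*} [NormedAddCommGroup E'] [NormedSpace ℝ E'] [FiniteDimensional ℝ E']
  {S : Type*} [TopologicalSpace S] [ChartedSpace E' S] [IsManifold 𝓘(ℝ, E') ∞ S]
  [RiemannianBundle (fun y : S => TangentSpace 𝓘(ℝ, E') y)]
  {cov : CovariantDerivative 𝓘(ℝ, E) E (fun y : M => TangentSpace 𝓘(ℝ, E) y)}
  {F : S → M} {N V : (x : S) → TangentSpace 𝓘(ℝ, E) (F x)} {θ f : S → ℝ}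

theorem covAlong_inner_add_of_eventually_const (hcov : IsLeviCivita cov)
    {W Z : (x : S) → TangentSpace 𝓘(ℝ, E) (F x)} {x : S} {c : ℝ}
    (hF : MDifferentiableAt 𝓘(ℝ, E') 𝓘(ℝ, E) F x)
    (hW : MDifferentiableAt 𝓘(ℝ, E') 𝓘(ℝ, E).tangent (fun q => (⟨F q, W q⟩ : TangentBundle 𝓘(ℝ, E) M)) x)
    (hZ : MDifferentiableAt 𝓘(ℝ, E') 𝓘(ℝ, E).tangent (fun q => (⟨F q, Z q⟩ : TangentBundle 𝓘(ℝ, E) M)) x)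
    (hc : ∀ᶠ q in 𝓝 x, inner ℝ (W q) (Z q) = c) (a : TangentSpace 𝓘(ℝ, E') x) :
    inner ℝ (covAlong (J := 𝓘(ℝ, E')) cov F W x a) (Z x) + inner ℝ (W x) (covAlong (J := 𝓘(ℝ, E')) cov F Z x a) = 0 := by
  have : IsContMDiffRiemannianBundle 𝓘(ℝ, E) 1 E (fun y : M => TangentSpace 𝓘(ℝ, E) y) :=
    IsContMDiffRiemannianBundle.of_le (n := ∞) ENat.LEInfty.out
  rw [← covAlong_metric hcov hF hW hZ, mvfderiv_congr (g := fun _ => c) hc, mvfderiv_const]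
  rfl

theorem mvfderiv_comp_hasDerivAt {g : ℝ → ℝ} {g' : ℝ} {x : S} (hg : HasDerivAt g g' (θ x))
    (hθ : MDifferentiableAt 𝓘(ℝ, E') 𝓘(ℝ, ℝ) θ x) (a : TangentSpace 𝓘(ℝ, E') x) :
    mvfderiv 𝓘(ℝ, E') (fun q => g (θ q)) x a = g' * mvfderiv 𝓘(ℝ, E') θ x a := by
  have h := mvfderiv_comp_apply (g := g) x hg.differentiableAt.mdifferentiableAt hθ a
  refine h.trans ?_
  have h2 : mfderiv 𝓘(ℝ, ℝ) 𝓘(ℝ, ℝ) g (θ x) = ContinuousLinearMap.toSpanSingleton ℝ g' := by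
    rw [mfderiv_eq_fderiv]; exact hg.hasFDerivAt.fderiv
  refine (congrArg (fun L : ℝ →L[ℝ] ℝ => L (mvfderiv 𝓘(ℝ, E') θ x a)) h2).trans ?_
  simp [mul_comm]

theorem IsPrescribedAngle.field_eq (hPA : IsPrescribedAngle 𝓘(ℝ, E) 𝓘(ℝ, E') F N V θ) {x : S}
    {e : TangentSpace 𝓘(ℝ, E') x}
    (hT : tangentialPart 𝓘(ℝ, E) 𝓘(ℝ, E') F x (V x) = Real.sin (θ x) • e) :
    V x = Real.sin (θ x) • mfderiv 𝓘(ℝ, E') 𝓘(ℝ, E) F x e + Real.cos (θ x) • N x := by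
  have hiso : ∀ a b : TangentSpace 𝓘(ℝ, E') x, inner ℝ (mfderiv 𝓘(ℝ, E') 𝓘(ℝ, E) F x a) (mfderiv 𝓘(ℝ, E') 𝓘(ℝ, E) F x b)
    = inner ℝ a b := hPA.isometric x
  have hno : ∀ a : TangentSpace 𝓘(ℝ, E') x, inner ℝ (N x) (mfderiv 𝓘(ℝ, E') 𝓘(ℝ, E) F x a) = 0 := hPA.normal_orthogonal x
  rw [← sub_eq_zero]
  apply hPA.toIsHypersurface.eq_zero
  · rw [inner_sub_left, inner_add_left, inner_smul_left, inner_smul_left, hPA.inner_normal,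
      real_inner_self_eq_norm_sq, hPA.normal_unit, real_inner_comm, hno]
    simp
  · intro a
    rw [inner_sub_left, inner_add_left, inner_smul_left, inner_smul_left, hno, hiso, ← inner_tangentialPart, hT, inner_smul_left]
    simp

/-- Part (i) for an arbitrary tangent direction, obtained by differentiating `⟨V, N⟩ = cos θ`. The
values in `[0, π/2]` together with `θ x ≠ 0` make `sin θ` invertible. -/
theorem mvfderiv_angle (hcov : IsLeviCivita cov) (hPA : IsPrescribedAngle 𝓘(ℝ, E) 𝓘(ℝ, E') F N V θ)
    (hV : IsAntiTorquedAlong 𝓘(ℝ, E') cov F V f) {x : S} (hθ : θ x ≠ 0)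
    {e : TangentSpace 𝓘(ℝ, E') x} (hT : tangentialPart 𝓘(ℝ, E) 𝓘(ℝ, E') F x (V x) = Real.sin (θ x) • e)
    (a : TangentSpace 𝓘(ℝ, E') x) :
    mvfderiv 𝓘(ℝ, E') θ x a = inner ℝ (shapeOperator cov F N x a) e + f x * Real.cos (θ x) * inner ℝ a e := by
  have : IsContMDiffRiemannianBundle 𝓘(ℝ, E) 1 E (fun y : M => TangentSpace 𝓘(ℝ, E) y) :=
    IsContMDiffRiemannianBundle.of_le (n := ∞) ENat.LEInfty.out
  have hs : Real.sin (θ x) ≠ 0 := by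
    have := hPA.angle_mem x
    refine (Real.sin_pos_of_pos_of_lt_pi (lt_of_le_of_ne this.1 (Ne.symm hθ)) ?_).ne'
    linarith [this.2, Real.pi_pos]
  have hFd : MDifferentiableAt 𝓘(ℝ, E') 𝓘(ℝ, E) F x := hPA.smooth.contMDiffAt.mdifferentiableAt (by simp)
  have hVd := (hPA.field_smooth.contMDiffAt (x := x)).mdifferentiableAt (by simp)
  have hNd := (hPA.normal_smooth.contMDiffAt (x := x)).mdifferentiableAt (by simp)
  have h1 := covAlong_metric hcov hFd hVd hNd a
  -- Since `N` is unit, `∇_a N` is orthogonal to `N`, so in `⟨V, ∇_a N⟩` only the tangential part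
  -- `sin θ dF(e)` of `V` counts.
  have hNN := covAlong_inner_add_of_eventually_const hcov hFd hNd hNd (c := 1)
    (Filter.Eventually.of_forall fun q => by rw [real_inner_self_eq_norm_sq, hPA.normal_unit]; norm_num) a
  have hno : ∀ a : TangentSpace 𝓘(ℝ, E') x, inner ℝ (tangentMapAt 𝓘(ℝ, E) 𝓘(ℝ, E') F x a) (N x) = 0 := fun a => by
    rw [real_inner_comm]; exact hPA.normal_orthogonal x a
  have hVt : inner ℝ (tangentMapAt 𝓘(ℝ, E) 𝓘(ℝ, E') F x a) (V x) = Real.sin (θ x) * inner ℝ a e := by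
    rw [real_inner_comm]
    refine (inner_tangentialPart F x (V x) a).symm.trans ?_
    rw [hT, inner_smul_left, real_inner_comm]
    simp
  have h2 : mvfderiv 𝓘(ℝ, E') (fun q => inner ℝ (V q) (N q)) x a = -Real.sin (θ x) * mvfderiv 𝓘(ℝ, E') θ x a := by
    simp only [hPA.inner_normal]
    exact mvfderiv_comp_hasDerivAt (Real.hasDerivAt_cos (θ x)) (hPA.angle_smooth.contMDiffAt.mdifferentiableAt (by simp)) a
  rw [real_inner_comm, ← two_mul] at hNN
  have hNN' : inner ℝ (N x) (covAlong (J := 𝓘(ℝ, E')) cov F N x a) = 0 := by simpa using hNN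
  rw [h2, hV.cov_eq, inner_smul_left, inner_sub_left, inner_smul_left, hno, hVt, hPA.inner_normal] at h1
  rw [hPA.field_eq hT] at h1
  rw [inner_add_left, inner_smul_left, inner_smul_left, hNN'] at h1
  rw [inner_shapeOperator, real_inner_comm (mfderiv 𝓘(ℝ, E') 𝓘(ℝ, E) F x e)]
  simp at h1
  apply mul_left_cancel₀ hs
  linarith

/-- The second fundamental form `⟨∇_a dF(e₂), dF(e₁)⟩` of the frame, read along the surface. -/
theorem inner_covAlong_frame (hcov : IsLeviCivita cov) (hPA : IsPrescribedAngle 𝓘(ℝ, E) 𝓘(ℝ, E') F N V θ)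
    (hV : IsAntiTorquedAlong 𝓘(ℝ, E') cov F V f) {U : Set S} (hU : IsOpen U) {x : S} (hx : x ∈ U)
    {e₁ e₂ : (x : S) → TangentSpace 𝓘(ℝ, E') x}
    (he₂ : MDifferentiableAt 𝓘(ℝ, E') 𝓘(ℝ, E').tangent (fun x => (⟨x, e₂ x⟩ : TangentBundle 𝓘(ℝ, E') S)) x)
    (h₁₂ : ∀ x ∈ U, inner ℝ (e₁ x) (e₂ x) = 0)
    (hT : ∀ x ∈ U, tangentialPart 𝓘(ℝ, E) 𝓘(ℝ, E') F x (V x) = Real.sin (θ x) • e₁ x)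
    (a : TangentSpace 𝓘(ℝ, E') x) :
    Real.sin (θ x) * inner ℝ (mfderiv 𝓘(ℝ, E') 𝓘(ℝ, E) F x (e₁ x))
      (covAlong (J := 𝓘(ℝ, E')) cov F (fun q => mfderiv 𝓘(ℝ, E') 𝓘(ℝ, E) F q (e₂ q)) x a) =
    -(f x * inner ℝ a (e₂ x) + Real.cos (θ x) * inner ℝ (shapeOperator cov F N x a) (e₂ x)) := by
  have hFd : MDifferentiableAt 𝓘(ℝ, E') 𝓘(ℝ, E) F x := hPA.smooth.contMDiffAt.mdifferentiableAt (by simp)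
  have hVd := (hPA.field_smooth.contMDiffAt (x := x)).mdifferentiableAt (by simp)
  have hNd := (hPA.normal_smooth.contMDiffAt (x := x)).mdifferentiableAt (by simp)
  have hWd : MDifferentiableAt 𝓘(ℝ, E') 𝓘(ℝ, E).tangent
      (fun q => (⟨F q, mfderiv 𝓘(ℝ, E') 𝓘(ℝ, E) F q (e₂ q)⟩ : TangentBundle 𝓘(ℝ, E) M)) x :=
    (hPA.smooth.contMDiff_tangentMap (m := ∞) (by simp)).contMDiffAt.mdifferentiableAt (by simp) |>.comp x he₂
  have hVt : ∀ q ∈ U, inner ℝ (V q) (mfderiv 𝓘(ℝ, E') 𝓘(ℝ, E) F q (e₂ q)) = 0 := fun q hq => by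
    rw [← inner_tangentialPart, hT q hq, inner_smul_left, h₁₂ q hq, mul_zero]
  have hno : ∀ q, ∀ a : TangentSpace 𝓘(ℝ, E') q, inner ℝ (N q) (mfderiv 𝓘(ℝ, E') 𝓘(ℝ, E) F q a) = 0 :=
    hPA.normal_orthogonal
  have h1 := covAlong_inner_add_of_eventually_const hcov hFd hVd hWd (c := 0)
    (by filter_upwards [hU.mem_nhds hx] with q hq using hVt q hq) a
  have h2 := covAlong_inner_add_of_eventually_const hcov hFd hNd hWd (c := 0)
    (Filter.Eventually.of_forall fun q => hno q _) a
  have hiso : ∀ a b : TangentSpace 𝓘(ℝ, E') x, inner ℝ (tangentMapAt 𝓘(ℝ, E) 𝓘(ℝ, E') F x a) (mfderiv 𝓘(ℝ, E') 𝓘(ℝ, E) F x b)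
    = inner ℝ a b := hPA.isometric x
  -- As `V` is orthogonal to `dF(e₂)`, the projection term of the anti-torqued equation drops out
  -- and `f ⟨a, e₂⟩` remains.
  rw [hV.cov_eq, inner_smul_left, inner_sub_left, inner_smul_left, hVt x hx, hiso] at h1
  rw [hPA.field_eq (hT x hx), inner_add_left, inner_smul_left, inner_smul_left] at h1
  rw [inner_shapeOperator]
  simp at h1
  linear_combination h1 - Real.cos (θ x) * h2
end

section
variable {E : Type*} [NormedAddCommGroup E] [NormedSpace ℝ E] [FiniteDimensional ℝ E]
  {M : Type*} [TopologicalSpace M] [ChartedSpace E M] [IsManifold 𝓘(ℝ, E) ∞ M]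
  [RiemannianBundle (fun y : M => TangentSpace 𝓘(ℝ, E) y)]
  [IsContMDiffRiemannianBundle 𝓘(ℝ, E) ∞ E (fun y : M => TangentSpace 𝓘(ℝ, E) y)]
  {E' : Type*} [NormedAddCommGroup E'] [NormedSpace ℝ E'] [FiniteDimensional ℝ E']
  {S : Type*} [TopologicalSpace S] [ChartedSpace E' S] [IsManifold 𝓘(ℝ, E') ∞ S]
  [RiemannianBundle (fun y : S => TangentSpace 𝓘(ℝ, E') y)]
  {cov : CovariantDerivative 𝓘(ℝ, E) E (fun y : M => TangentSpace 𝓘(ℝ, E) y)}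
  {F : S → M} {N V : (x : S) → TangentSpace 𝓘(ℝ, E) (F x)} {θ f : S → ℝ}

/-- The bracket is read off from `∇_{e₁} dF(e₂) - ∇_{e₂} dF(e₁)`. Its `e₁`-component vanishes
because `e₁` is principal and orthogonal to `e₂`; in its `e₂`-component the unit length of `e₂`
leaves only `-⟨∇_{e₂} dF(e₁), dF(e₂)⟩`, which is `-B`. -/
theorem mlieBracket_frame (hcov : IsLeviCivita cov) (hPA : IsPrescribedAngle 𝓘(ℝ, E) 𝓘(ℝ, E') F N V θ)
    (hV : IsAntiTorquedAlong 𝓘(ℝ, E') cov F V f) (hE' : Module.finrank ℝ E' = 2)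
    {U : Set S} (hU : IsOpen U) {x : S} (hx : x ∈ U)
    (hθ : θ x ≠ 0) {e₁ e₂ : (x : S) → TangentSpace 𝓘(ℝ, E') x}
    (he₁ : MDifferentiableAt 𝓘(ℝ, E') 𝓘(ℝ, E').tangent (fun x => (⟨x, e₁ x⟩ : TangentBundle 𝓘(ℝ, E') S)) x)
    (he₂ : MDifferentiableAt 𝓘(ℝ, E') 𝓘(ℝ, E').tangent (fun x => (⟨x, e₂ x⟩ : TangentBundle 𝓘(ℝ, E') S)) x)
    (h₁₁ : ∀ x ∈ U, ‖e₁ x‖ = 1) (h₂₂ : ∀ x ∈ U, ‖e₂ x‖ = 1) (h₁₂ : ∀ x ∈ U, inner ℝ (e₁ x) (e₂ x) = 0)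
    {k₁ k₂ : ℝ} (hκ₁ : shapeOperator cov F N x (e₁ x) = k₁ • e₁ x)
    (hκ₂ : shapeOperator cov F N x (e₂ x) = k₂ • e₂ x)
    (hT : ∀ x ∈ U, tangentialPart 𝓘(ℝ, E) 𝓘(ℝ, E') F x (V x) = Real.sin (θ x) • e₁ x) :
    mlieBracket 𝓘(ℝ, E') e₁ e₂ x = -(((f x + k₂ * Real.cos (θ x)) / Real.sin (θ x)) • e₂ x) := by
  have hs : Real.sin (θ x) ≠ 0 := by
    have := hPA.angle_mem x
    refine (Real.sin_pos_of_pos_of_lt_pi (lt_of_le_of_ne this.1 (Ne.symm hθ)) ?_).ne'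
    linarith [this.2, Real.pi_pos]
  have hFd : MDifferentiableAt 𝓘(ℝ, E') 𝓘(ℝ, E) F x := hPA.smooth.contMDiffAt.mdifferentiableAt (by simp)
  have hd : ∀ {e : (x : S) → TangentSpace 𝓘(ℝ, E') x},
    MDifferentiableAt 𝓘(ℝ, E') 𝓘(ℝ, E').tangent (fun x => (⟨x, e x⟩ : TangentBundle 𝓘(ℝ, E') S)) x →
      MDifferentiableAt 𝓘(ℝ, E') 𝓘(ℝ, E).tangent
      (fun q => (⟨F q, mfderiv 𝓘(ℝ, E') 𝓘(ℝ, E) F q (e q)⟩ : TangentBundle 𝓘(ℝ, E) M)) x := fun he =>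
    (hPA.smooth.contMDiff_tangentMap (m := ∞) (by simp)).contMDiffAt.mdifferentiableAt (by simp) |>.comp x he
  have hiso : ∀ q, ∀ a b : TangentSpace 𝓘(ℝ, E') q, inner ℝ (mfderiv 𝓘(ℝ, E') 𝓘(ℝ, E) F q a) (mfderiv 𝓘(ℝ, E') 𝓘(ℝ, E) F q b)
    = inner ℝ a b := hPA.isometric
  have hUx := hU.mem_nhds hx
  have h11 := covAlong_inner_add_of_eventually_const hcov hFd (hd he₁) (hd he₁) (c := 1)
    (by filter_upwards [hUx] with q hq; rw [hiso, real_inner_self_eq_norm_sq, h₁₁ q hq]; norm_num) (e₂ x)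
  have h22 := covAlong_inner_add_of_eventually_const hcov hFd (hd he₂) (hd he₂) (c := 1)
    (by filter_upwards [hUx] with q hq; rw [hiso, real_inner_self_eq_norm_sq, h₂₂ q hq]; norm_num) (e₁ x)
  have h12 := covAlong_inner_add_of_eventually_const hcov hFd (hd he₁) (hd he₂) (c := 0)
    (by filter_upwards [hUx] with q hq; rw [hiso, h₁₂ q hq]) (e₂ x)
  have k1 := inner_covAlong_frame hcov hPA hV hU hx he₂ h₁₂ hT (e₁ x)
  have k2 := inner_covAlong_frame hcov hPA hV hU hx he₂ h₁₂ hT (e₂ x)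
  have hb := covAlong_mfderiv_sub hcov hPA.smooth he₁ he₂
  rw [hκ₁, inner_smul_left, h₁₂ x hx, mul_zero, mul_zero, mul_zero, add_zero, neg_zero] at k1
  rw [hκ₂, inner_smul_left, real_inner_self_eq_norm_sq, h₂₂ x hx] at k2
  have k1' := (mul_eq_zero.1 k1).resolve_left hs
  set W₁ : (q : S) → TangentSpace 𝓘(ℝ, E) (F q) := fun q => mfderiv 𝓘(ℝ, E') 𝓘(ℝ, E) F q (e₁ q) with hW₁
  set W₂ : (q : S) → TangentSpace 𝓘(ℝ, E) (F q) := fun q => mfderiv 𝓘(ℝ, E') 𝓘(ℝ, E) F q (e₂ q) with hW₂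
  rw [real_inner_comm (W₁ x), ← two_mul] at h11
  rw [real_inner_comm (W₂ x), ← two_mul] at h22
  have h11' : inner ℝ (W₁ x) (covAlong (J := 𝓘(ℝ, E')) cov F W₁ x (e₂ x)) = 0 := by simpa using h11
  have h22' : inner ℝ (W₂ x) (covAlong (J := 𝓘(ℝ, E')) cov F W₂ x (e₁ x)) = 0 := by simpa using h22
  have hfin : Module.finrank ℝ (TangentSpace 𝓘(ℝ, E') x) = 2 := hE'
  rw [eq_smul_add_smul_of_orthonormal hfin (h₁₁ x hx) (h₂₂ x hx) (h₁₂ x hx) (mlieBracket 𝓘(ℝ, E') e₁ e₂ x)]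
  rw [← hiso, ← hiso, ← hb, inner_sub_left, inner_sub_left, real_inner_comm (W₁ x), k1',
    real_inner_comm (W₁ x), h11', real_inner_comm (W₂ x), h22']
  have h3 : inner ℝ (covAlong (J := 𝓘(ℝ, E')) cov F W₁ x (e₂ x)) (W₂ x) = (f x + k₂ * Real.cos (θ x)) / Real.sin (θ x) := by
    rw [eq_div_iff hs]
    simp at k2
    linear_combination Real.sin (θ x) * h12 - k2
  rw [h3]
  simp
end

/-! ### Connection and curvature of a surface from the bracket of a frame -/

section
variable {E : Type*} [NormedAddCommGroup E] [NormedSpace ℝ E] [FiniteDimensional ℝ E]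
  {S : Type*} [TopologicalSpace S] [ChartedSpace E S] [IsManifold 𝓘(ℝ, E) ∞ S]
  [RiemannianBundle (fun y : S => TangentSpace 𝓘(ℝ, E) y)]
  {cov : CovariantDerivative 𝓘(ℝ, E) E (fun y : S => TangentSpace 𝓘(ℝ, E) y)}

theorem IsLeviCivita.inner_add_of_eventually_const (hcov : IsLeviCivita cov) {x : S}
    {Y Z : (x : S) → TangentSpace 𝓘(ℝ, E) x} {c : ℝ}
    (hY : MDifferentiableAt 𝓘(ℝ, E) 𝓘(ℝ, E).tangent (fun x => (⟨x, Y x⟩ : TangentBundle 𝓘(ℝ, E) S)) x)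
    (hZ : MDifferentiableAt 𝓘(ℝ, E) 𝓘(ℝ, E).tangent (fun x => (⟨x, Z x⟩ : TangentBundle 𝓘(ℝ, E) S)) x)
    (hc : ∀ᶠ q in 𝓝 x, inner ℝ (Y q) (Z q) = c) (a : TangentSpace 𝓘(ℝ, E) x) :
    inner ℝ (cov Y x a) (Z x) + inner ℝ (Y x) (cov Z x a) = 0 := by
  rw [← hcov.metric x a Y Z hY hZ, mvfderiv_congr (g := fun _ => c) hc, mvfderiv_const]
  rfl

/-- The connection form of an orthonormal frame `e₁, e₂` with `[e₁, e₂] = -b e₂`. -/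
theorem IsLeviCivita.cov_frame (hcov : IsLeviCivita cov) (hE : Module.finrank ℝ E = 2)
    {U : Set S} (hU : IsOpen U) {x : S} (hx : x ∈ U) {e₁ e₂ : (x : S) → TangentSpace 𝓘(ℝ, E) x}
    (he₁ : MDifferentiableAt 𝓘(ℝ, E) 𝓘(ℝ, E).tangent (fun x => (⟨x, e₁ x⟩ : TangentBundle 𝓘(ℝ, E) S)) x)
    (he₂ : MDifferentiableAt 𝓘(ℝ, E) 𝓘(ℝ, E).tangent (fun x => (⟨x, e₂ x⟩ : TangentBundle 𝓘(ℝ, E) S)) x)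
    (h₁₁ : ∀ x ∈ U, ‖e₁ x‖ = 1) (h₂₂ : ∀ x ∈ U, ‖e₂ x‖ = 1) (h₁₂ : ∀ x ∈ U, inner ℝ (e₁ x) (e₂ x) = 0)
    {b : ℝ} (hb : mlieBracket 𝓘(ℝ, E) e₁ e₂ x = -(b • e₂ x)) (a : TangentSpace 𝓘(ℝ, E) x) :
    cov e₁ x a = (b * inner ℝ a (e₂ x)) • e₂ x ∧ cov e₂ x a = -((b * inner ℝ a (e₂ x)) • e₁ x) := by
  have hUx := hU.mem_nhds hx
  have hfin : Module.finrank ℝ (TangentSpace 𝓘(ℝ, E) x) = 2 := hE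
  have h11 := fun a => hcov.inner_add_of_eventually_const he₁ he₁ (c := 1)
    (by filter_upwards [hUx] with q hq; rw [real_inner_self_eq_norm_sq, h₁₁ q hq]; norm_num) a
  have h22 := fun a => hcov.inner_add_of_eventually_const he₂ he₂ (c := 1)
    (by filter_upwards [hUx] with q hq; rw [real_inner_self_eq_norm_sq, h₂₂ q hq]; norm_num) a
  have h12 := fun a => hcov.inner_add_of_eventually_const he₁ he₂ (c := 0)
    (by filter_upwards [hUx] with q hq; rw [h₁₂ q hq]) a
  have ht := (CovariantDerivative.torsion_eq_zero_iff cov).1 hcov.torsion_free he₁ he₂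
  rw [hb] at ht
  have h11' : ∀ a, inner ℝ (cov e₁ x a) (e₁ x) = 0 := fun a => by
    have := h11 a; rw [real_inner_comm (e₁ x), ← two_mul] at this; rw [real_inner_comm]; simpa using this
  have h22' : ∀ a, inner ℝ (cov e₂ x a) (e₂ x) = 0 := fun a => by
    have := h22 a; rw [real_inner_comm (e₂ x), ← two_mul] at this; rw [real_inner_comm]; simpa using this
  have t1 := congrArg (fun v => inner ℝ v (e₁ x)) ht
  have t2 := congrArg (fun v => inner ℝ v (e₂ x)) ht
  simp only [inner_sub_left, inner_neg_left, inner_smul_left, h11', h22', real_inner_self_eq_norm_sq, h₂₂ x hx,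
    real_inner_comm (e₁ x) (e₂ x), h₁₂ x hx] at t1 t2
  rw [real_inner_comm (e₁ x)] at t1
  simp at t1 t2
  -- The connection form is linear in `a`, so two values suffice: the two components of the torsion
  -- equation give `0` on `e₁` (with `h12`) and `b` on `e₂`.
  have hc : ∀ a, inner ℝ (cov e₁ x a) (e₂ x) = b * inner ℝ a (e₂ x) := by
    intro a
    conv_lhs => rw [eq_smul_add_smul_of_orthonormal hfin (h₁₁ x hx) (h₂₂ x hx) (h₁₂ x hx) a]
    rw [map_add, map_smul, map_smul, inner_add_left, inner_smul_left, inner_smul_left, t2]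
    have := h12 (e₁ x)
    have h3 : inner ℝ (cov e₁ x (e₁ x)) (e₂ x) = 0 := by linarith
    rw [h3]; simp [mul_comm]
  constructor
  · rw [eq_smul_add_smul_of_orthonormal hfin (h₁₁ x hx) (h₂₂ x hx) (h₁₂ x hx) (cov e₁ x a), h11', hc]
    simp
  · rw [eq_smul_add_smul_of_orthonormal hfin (h₁₁ x hx) (h₂₂ x hx) (h₁₂ x hx) (cov e₂ x a), h22', real_inner_comm]
    have := h12 a
    rw [hc] at this
    have h3 : inner ℝ (e₁ x) (cov e₂ x a) = -(b * inner ℝ a (e₂ x)) := by linarith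
    rw [h3]; simp
end

section
variable {E : Type*} [NormedAddCommGroup E] [NormedSpace ℝ E] [FiniteDimensional ℝ E]
  {S : Type*} [TopologicalSpace S] [ChartedSpace E S] [IsManifold 𝓘(ℝ, E) ∞ S]
  [RiemannianBundle (fun y : S => TangentSpace 𝓘(ℝ, E) y)]
  {cov : CovariantDerivative 𝓘(ℝ, E) E (fun y : S => TangentSpace 𝓘(ℝ, E) y)}

theorem IsLeviCivita.inner_cov_frame (hcov : IsLeviCivita cov) (hE : Module.finrank ℝ E = 2)
    {U : Set S} (hU : IsOpen U) {x : S} (hx : x ∈ U) {e₁ e₂ Z : (x : S) → TangentSpace 𝓘(ℝ, E) x}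
    (he₁ : MDifferentiableAt 𝓘(ℝ, E) 𝓘(ℝ, E).tangent (fun x => (⟨x, e₁ x⟩ : TangentBundle 𝓘(ℝ, E) S)) x)
    (he₂ : MDifferentiableAt 𝓘(ℝ, E) 𝓘(ℝ, E).tangent (fun x => (⟨x, e₂ x⟩ : TangentBundle 𝓘(ℝ, E) S)) x)
    (hZ : MDifferentiableAt 𝓘(ℝ, E) 𝓘(ℝ, E).tangent (fun x => (⟨x, Z x⟩ : TangentBundle 𝓘(ℝ, E) S)) x)
    (h₁₁ : ∀ x ∈ U, ‖e₁ x‖ = 1) (h₂₂ : ∀ x ∈ U, ‖e₂ x‖ = 1) (h₁₂ : ∀ x ∈ U, inner ℝ (e₁ x) (e₂ x) = 0)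
    {b : ℝ} (hb : mlieBracket 𝓘(ℝ, E) e₁ e₂ x = -(b • e₂ x)) (a : TangentSpace 𝓘(ℝ, E) x) :
    inner ℝ (cov Z x a) (e₁ x) = mvfderiv 𝓘(ℝ, E) (fun y => inner ℝ (Z y) (e₁ y)) x a -
        b * inner ℝ a (e₂ x) * inner ℝ (Z x) (e₂ x) ∧
    inner ℝ (cov Z x a) (e₂ x) = mvfderiv 𝓘(ℝ, E) (fun y => inner ℝ (Z y) (e₂ y)) x a +
        b * inner ℝ a (e₂ x) * inner ℝ (Z x) (e₁ x) := by
  obtain ⟨h1, h2⟩ := hcov.cov_frame hE hU hx he₁ he₂ h₁₁ h₂₂ h₁₂ hb a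
  rw [hcov.metric x a Z e₁ hZ he₁, hcov.metric x a Z e₂ hZ he₂, h1, h2, inner_neg_right, inner_smul_right, inner_smul_right]
  constructor <;> ring

theorem mvfderiv_add_mul_mul {x : S} {g b y z : S → ℝ} (hg : MDifferentiableAt 𝓘(ℝ, E) 𝓘(ℝ, ℝ) g x)
    (hb : MDifferentiableAt 𝓘(ℝ, E) 𝓘(ℝ, ℝ) b x) (hy : MDifferentiableAt 𝓘(ℝ, E) 𝓘(ℝ, ℝ) y x)
    (hz : MDifferentiableAt 𝓘(ℝ, E) 𝓘(ℝ, ℝ) z x) (a : TangentSpace 𝓘(ℝ, E) x) :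
    MDifferentiableAt 𝓘(ℝ, E) 𝓘(ℝ, ℝ) (fun q => g q + b q * y q * z q) x ∧
    mvfderiv 𝓘(ℝ, E) (fun q => g q + b q * y q * z q) x a = mvfderiv 𝓘(ℝ, E) g x a +
      (mvfderiv 𝓘(ℝ, E) b x a * y x * z x + b x * mvfderiv 𝓘(ℝ, E) y x a * z x + b x * y x * mvfderiv 𝓘(ℝ, E) z x a) := by
  have h1 : MDifferentiableAt 𝓘(ℝ, E) 𝓘(ℝ, ℝ) (fun q => b q * y q) x := hb.mul hy
  have h2 : MDifferentiableAt 𝓘(ℝ, E) 𝓘(ℝ, ℝ) (fun q => b q * y q * z q) x := h1.mul hz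
  refine ⟨hg.add h2, ?_⟩
  rw [mvfderiv_fun_add hg h2, mvfderiv_fun_mul h1 hz, mvfderiv_fun_mul hb hy]
  simp
  ring

variable [IsContMDiffRiemannianBundle 𝓘(ℝ, E) ∞ E (fun y : S => TangentSpace 𝓘(ℝ, E) y)]

/-- The curvature of a surface in terms of an orthonormal frame with `[e₁, e₂] = -b e₂`. -/
theorem IsLeviCivita.curvatureField_frame (hcov : IsLeviCivita cov) (hE : Module.finrank ℝ E = 2)
    {U : Set S} (hU : IsOpen U) {x : S} (hx : x ∈ U) {e₁ e₂ X Y Z : (x : S) → TangentSpace 𝓘(ℝ, E) x}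
    (he₁ : ContMDiffOn 𝓘(ℝ, E) 𝓘(ℝ, E).tangent ∞ (fun x => (⟨x, e₁ x⟩ : TangentBundle 𝓘(ℝ, E) S)) U)
    (he₂ : ContMDiffOn 𝓘(ℝ, E) 𝓘(ℝ, E).tangent ∞ (fun x => (⟨x, e₂ x⟩ : TangentBundle 𝓘(ℝ, E) S)) U)
    (hX : ContMDiffAt 𝓘(ℝ, E) 𝓘(ℝ, E).tangent ∞ (fun x => (⟨x, X x⟩ : TangentBundle 𝓘(ℝ, E) S)) x)
    (hY : ContMDiffAt 𝓘(ℝ, E) 𝓘(ℝ, E).tangent ∞ (fun x => (⟨x, Y x⟩ : TangentBundle 𝓘(ℝ, E) S)) x)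
    (hZ : ContMDiffAt 𝓘(ℝ, E) 𝓘(ℝ, E).tangent ∞ (fun x => (⟨x, Z x⟩ : TangentBundle 𝓘(ℝ, E) S)) x)
    (h₁₁ : ∀ x ∈ U, ‖e₁ x‖ = 1) (h₂₂ : ∀ x ∈ U, ‖e₂ x‖ = 1) (h₁₂ : ∀ x ∈ U, inner ℝ (e₁ x) (e₂ x) = 0)
    {b : S → ℝ} (hbd : MDifferentiableAt 𝓘(ℝ, E) 𝓘(ℝ, ℝ) b x)
    (hb : ∀ x ∈ U, mlieBracket 𝓘(ℝ, E) e₁ e₂ x = -(b x • e₂ x)) :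
    curvatureField cov X Y Z x =
      ((inner ℝ (X x) (e₁ x) * inner ℝ (Y x) (e₂ x) - inner ℝ (X x) (e₂ x) * inner ℝ (Y x) (e₁ x)) *
        (mvfderiv 𝓘(ℝ, E) b x (e₁ x) + b x ^ 2)) •
        (inner ℝ (Z x) (e₁ x) • e₂ x - inner ℝ (Z x) (e₂ x) • e₁ x) := by
  have hUx := hU.mem_nhds hx
  have hfin : Module.finrank ℝ (TangentSpace 𝓘(ℝ, E) x) = 2 := hE
  have hc1 := fun y hy => he₁.contMDiffAt (hU.mem_nhds (x := y) hy)
  have hc2 := fun y hy => he₂.contMDiffAt (hU.mem_nhds (x := y) hy)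
  have hd1 := fun y hy => (hc1 y hy).mdifferentiableAt (by simp)
  have hd2 := fun y hy => (hc2 y hy).mdifferentiableAt (by simp)
  have hXd := hX.mdifferentiableAt (by simp)
  have hYd := hY.mdifferentiableAt (by simp)
  have hZd := hZ.mdifferentiableAt (by simp)
  have hin : ∀ {P Q : (x : S) → TangentSpace 𝓘(ℝ, E) x},
      ContMDiffAt 𝓘(ℝ, E) 𝓘(ℝ, E).tangent ∞ (fun x => (⟨x, P x⟩ : TangentBundle 𝓘(ℝ, E) S)) x →
      ContMDiffAt 𝓘(ℝ, E) 𝓘(ℝ, E).tangent ∞ (fun x => (⟨x, Q x⟩ : TangentBundle 𝓘(ℝ, E) S)) x →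
      ContMDiffAt 𝓘(ℝ, E) 𝓘(ℝ, ℝ) ∞ (fun y => inner ℝ (P y) (Q y)) x := fun hP hQ =>
    ContMDiffAt.inner_bundle (E := fun y : S => TangentSpace 𝓘(ℝ, E) y) hP hQ
  set z₁ : S → ℝ := fun y => inner ℝ (Z y) (e₁ y)
  set z₂ : S → ℝ := fun y => inner ℝ (Z y) (e₂ y)
  have hz₁ : ContMDiffAt 𝓘(ℝ, E) 𝓘(ℝ, ℝ) ∞ z₁ x := hin hZ (hc1 x hx)
  have hz₂ : ContMDiffAt 𝓘(ℝ, E) 𝓘(ℝ, ℝ) ∞ z₂ x := hin hZ (hc2 x hx)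
  have hz₁d := hz₁.mdifferentiableAt (by simp)
  have hz₂d := hz₂.mdifferentiableAt (by simp)
  have hZev : ∀ᶠ y in 𝓝 x, MDifferentiableAt 𝓘(ℝ, E) 𝓘(ℝ, E).tangent (fun x => (⟨x, Z x⟩ : TangentBundle 𝓘(ℝ, E) S)) y := by
    have := (contMDiffAt_iff_contMDiffAt_nhds (by simp)).1 (hZ.of_le (m := 1) ENat.LEInfty.out)
    exact this.mono fun y hy => hy.mdifferentiableAt (by simp)
  -- the components of `∇_W Z`
  have key : ∀ W : (x : S) → TangentSpace 𝓘(ℝ, E) x,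
      ContMDiffAt 𝓘(ℝ, E) 𝓘(ℝ, E).tangent ∞ (fun x => (⟨x, W x⟩ : TangentBundle 𝓘(ℝ, E) S)) x → ∀ a,
      inner ℝ (cov (fun y => cov Z y (W y)) x a) (e₁ x) =
        mvfderiv 𝓘(ℝ, E) (fun y => mvfderiv 𝓘(ℝ, E) z₁ y (W y)) x a -
        (mvfderiv 𝓘(ℝ, E) b x a * inner ℝ (W x) (e₂ x) * z₂ x +
          b x * mvfderiv 𝓘(ℝ, E) (fun y => inner ℝ (W y) (e₂ y)) x a * z₂ x +
          b x * inner ℝ (W x) (e₂ x) * mvfderiv 𝓘(ℝ, E) z₂ x a) -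
        b x * inner ℝ a (e₂ x) * (mvfderiv 𝓘(ℝ, E) z₂ x (W x) + b x * inner ℝ (W x) (e₂ x) * z₁ x) ∧
      inner ℝ (cov (fun y => cov Z y (W y)) x a) (e₂ x) =
        mvfderiv 𝓘(ℝ, E) (fun y => mvfderiv 𝓘(ℝ, E) z₂ y (W y)) x a +
        (mvfderiv 𝓘(ℝ, E) b x a * inner ℝ (W x) (e₂ x) * z₁ x +
          b x * mvfderiv 𝓘(ℝ, E) (fun y => inner ℝ (W y) (e₂ y)) x a * z₁ x +
          b x * inner ℝ (W x) (e₂ x) * mvfderiv 𝓘(ℝ, E) z₁ x a) +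
        b x * inner ℝ a (e₂ x) * (mvfderiv 𝓘(ℝ, E) z₁ x (W x) - b x * inner ℝ (W x) (e₂ x) * z₂ x) := by
    intro W hW a
    have hWd := hW.mdifferentiableAt (by simp)
    set w₂ : S → ℝ := fun y => inner ℝ (W y) (e₂ y) with hw₂
    have hw₂d : MDifferentiableAt 𝓘(ℝ, E) 𝓘(ℝ, ℝ) w₂ x := (hin hW (hc2 x hx)).mdifferentiableAt (by simp)
    obtain ⟨m1, d1⟩ := mvfderiv_add_mul_mul (mdifferentiableAt_mvfderiv_apply (hz₁.of_le ENat.LEInfty.out) hWd)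
      hbd.neg hw₂d hz₂d a
    obtain ⟨m2, d2⟩ := mvfderiv_add_mul_mul (mdifferentiableAt_mvfderiv_apply (hz₂.of_le ENat.LEInfty.out) hWd)
      hbd hw₂d hz₁d a
    set p₁ : S → ℝ := fun q => mvfderiv 𝓘(ℝ, E) z₁ q (W q) + (-b) q * w₂ q * z₂ q with hp₁
    set p₂ : S → ℝ := fun q => mvfderiv 𝓘(ℝ, E) z₂ q (W q) + b q * w₂ q * z₁ q with hp₂
    have c1 : ∀ᶠ y in 𝓝 x, inner ℝ (cov Z y (W y)) (e₁ y) = p₁ y ∧ inner ℝ (cov Z y (W y)) (e₂ y) = p₂ y := by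
      filter_upwards [hZev, hUx] with y hy hyU
      obtain ⟨q1, q2⟩ := hcov.inner_cov_frame hE hU hyU (hd1 y hyU) (hd2 y hyU) hy h₁₁ h₂₂ h₁₂ (hb y hyU) (W y)
      refine ⟨q1.trans ?_, q2⟩
      simp only [hp₁, Pi.neg_apply]
      change _ - b y * w₂ y * z₂ y = _
      ring
    -- Second derivatives need `y ↦ ∇_W Z` to be differentiable. This is deduced from its components
    -- in the frame, so no smoothness of `cov` itself has to be known.
    have hmd : MDifferentiableAt 𝓘(ℝ, E) 𝓘(ℝ, E).tangent
        (fun y => (⟨y, cov Z y (W y)⟩ : TangentBundle 𝓘(ℝ, E) S)) x := by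
      have := mdifferentiableAt_add_section (m1.smul_section (hd1 x hx)) (m2.smul_section (hd2 x hx))
      refine this.congr_of_eventuallyEq ?_
      filter_upwards [c1, hUx] with y hy hyU
      have hfin : Module.finrank ℝ (TangentSpace 𝓘(ℝ, E) y) = 2 := hE
      have := eq_smul_add_smul_of_orthonormal hfin (h₁₁ y hyU) (h₂₂ y hyU) (h₁₂ y hyU) (cov Z y (W y))
      rw [hy.1, hy.2] at this
      exact congrArg (fun v => (⟨y, v⟩ : TangentBundle 𝓘(ℝ, E) S)) this
    obtain ⟨q1, q2⟩ := hcov.inner_cov_frame hE hU hx (hd1 x hx) (hd2 x hx) hmd h₁₁ h₂₂ h₁₂ (hb x hx) a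
    rw [mvfderiv_congr (c1.mono fun y hy => hy.1), d1, c1.self_of_nhds.2] at q1
    rw [mvfderiv_congr (c1.mono fun y hy => hy.2), d2, c1.self_of_nhds.1] at q2
    refine ⟨q1.trans ?_, q2.trans ?_⟩
    · rw [mvfderiv_neg]
      simp only [hp₂, Pi.neg_apply]
      simp
      ring
    · simp only [hp₁, Pi.neg_apply]
      ring
  have hlb := hcov.inner_cov_frame hE hU hx (hd1 x hx) (hd2 x hx) hZd h₁₁ h₂₂ h₁₂ (hb x hx) (mlieBracket 𝓘(ℝ, E) X Y x)
  have hz1b := mvfderiv_mlieBracket (hz₁.of_le (m := 2) ENat.LEInfty.out) hXd hYd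
  have hz2b := mvfderiv_mlieBracket (hz₂.of_le (m := 2) ENat.LEInfty.out) hXd hYd
  have ht := (CovariantDerivative.torsion_eq_zero_iff cov).1 hcov.torsion_free hXd hYd
  have hX2 := (hcov.inner_cov_frame hE hU hx (hd1 x hx) (hd2 x hx) hXd h₁₁ h₂₂ h₁₂ (hb x hx) (Y x)).2
  have hY2 := (hcov.inner_cov_frame hE hU hx (hd1 x hx) (hd2 x hx) hYd h₁₁ h₂₂ h₁₂ (hb x hx) (X x)).2
  -- Torsion-freeness trades the bracket for derivatives of `⟨X, e₂⟩` and `⟨Y, e₂⟩`, which cancel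
  -- those produced by `key`.
  have hbr : inner ℝ (mlieBracket 𝓘(ℝ, E) X Y x) (e₂ x) =
    inner ℝ (cov Y x (X x)) (e₂ x) - inner ℝ (cov X x (Y x)) (e₂ x) := by
    rw [← ht, inner_sub_left]
  rw [hX2, hY2] at hbr
  have kY := key Y hY (X x)
  have kX := key X hX (Y x)
  -- After antisymmetrising in `X` and `Y`, the `e₂(b)` terms cancel and only `e₁(b)` is left.
  have hbe : ∀ v : TangentSpace 𝓘(ℝ, E) x, mvfderiv 𝓘(ℝ, E) b x v =
      inner ℝ v (e₁ x) * mvfderiv 𝓘(ℝ, E) b x (e₁ x) + inner ℝ v (e₂ x) * mvfderiv 𝓘(ℝ, E) b x (e₂ x) := fun v => by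
    conv_lhs => rw [eq_smul_add_smul_of_orthonormal hfin (h₁₁ x hx) (h₂₂ x hx) (h₁₂ x hx) v]
    simp
  rw [hbe (X x)] at kY
  rw [hbe (Y x)] at kX
  rw [hbr] at hlb
  have r1 : inner ℝ (curvatureField cov X Y Z x) (e₁ x) =
     -((inner ℝ (X x) (e₁ x) * inner ℝ (Y x) (e₂ x) - inner ℝ (X x) (e₂ x) * inner ℝ (Y x) (e₁ x)) *
        (mvfderiv 𝓘(ℝ, E) b x (e₁ x) + b x ^ 2)) * z₂ x := by
    rw [curvatureField, inner_sub_left, inner_sub_left, kY.1, kX.1, hlb.1]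
    rw [show (fun y => inner ℝ (Z y) (e₁ y)) = z₁ from rfl, show inner ℝ (Z x) (e₂ x) = z₂ x from rfl, ← hz1b]
    ring
  have r2 : inner ℝ (curvatureField cov X Y Z x) (e₂ x) =
     ((inner ℝ (X x) (e₁ x) * inner ℝ (Y x) (e₂ x) - inner ℝ (X x) (e₂ x) * inner ℝ (Y x) (e₁ x)) *
        (mvfderiv 𝓘(ℝ, E) b x (e₁ x) + b x ^ 2)) * z₁ x := by
    rw [curvatureField, inner_sub_left, inner_sub_left, kY.2, kX.2, hlb.2]
    rw [show (fun y => inner ℝ (Z y) (e₂ y)) = z₂ from rfl, show inner ℝ (Z x) (e₁ x) = z₁ x from rfl, ← hz2b]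
    ring
  rw [eq_smul_add_smul_of_orthonormal hfin (h₁₁ x hx) (h₂₂ x hx) (h₁₂ x hx) (curvatureField cov X Y Z x), r1, r2]
  simp only [smul_sub, smul_smul, neg_mul, neg_smul]
  abel
/-- A surface with an orthonormal frame such that `[e₁, e₂] = -b e₂` has curvature `-(e₁(b) + b²)`. -/
theorem IsLeviCivita.sectionalCurvature_frame (hcov : IsLeviCivita cov) (hE : Module.finrank ℝ E = 2)
    {U : Set S} (hU : IsOpen U) {x : S} (hx : x ∈ U) {e₁ e₂ : (x : S) → TangentSpace 𝓘(ℝ, E) x}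
    (he₁ : ContMDiffOn 𝓘(ℝ, E) 𝓘(ℝ, E).tangent ∞ (fun x => (⟨x, e₁ x⟩ : TangentBundle 𝓘(ℝ, E) S)) U)
    (he₂ : ContMDiffOn 𝓘(ℝ, E) 𝓘(ℝ, E).tangent ∞ (fun x => (⟨x, e₂ x⟩ : TangentBundle 𝓘(ℝ, E) S)) U)
    (h₁₁ : ∀ x ∈ U, ‖e₁ x‖ = 1) (h₂₂ : ∀ x ∈ U, ‖e₂ x‖ = 1) (h₁₂ : ∀ x ∈ U, inner ℝ (e₁ x) (e₂ x) = 0)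
    {b : S → ℝ} (hbd : MDifferentiableAt 𝓘(ℝ, E) 𝓘(ℝ, ℝ) b x)
    (hb : ∀ x ∈ U, mlieBracket 𝓘(ℝ, E) e₁ e₂ x = -(b x • e₂ x)) {X Y : TangentSpace 𝓘(ℝ, E) x}
    (hXY : LinearIndependent ℝ ![X, Y]) :
    sectionalCurvature cov x X Y = -(mvfderiv 𝓘(ℝ, E) b x (e₁ x) + b x ^ 2) := by
  have hfin : Module.finrank ℝ (TangentSpace 𝓘(ℝ, E) x) = 2 := hE
  have hX := eq_smul_add_smul_of_orthonormal hfin (h₁₁ x hx) (h₂₂ x hx) (h₁₂ x hx) X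
  have hY := eq_smul_add_smul_of_orthonormal hfin (h₁₁ x hx) (h₂₂ x hx) (h₁₂ x hx) Y
  have he : ∀ v : TangentSpace 𝓘(ℝ, E) x, ContMDiffAt 𝓘(ℝ, E) 𝓘(ℝ, E).tangent ∞
      (fun y => (⟨y, FiberBundle.extend E v y⟩ : TangentBundle 𝓘(ℝ, E) S)) x := fun v =>
    FiberBundle.contMDiffAt_extend _ _ v
  have hR := hcov.curvatureField_frame hE hU hx he₁ he₂ (he X) (he Y) (he Y) h₁₁ h₂₂ h₁₂ hbd hb
  simp only [FiberBundle.extend_apply_self] at hR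
  rw [sectionalCurvature, curvatureTensor, hR]
  have e11 : inner ℝ (e₁ x) (e₁ x) = 1 := by rw [real_inner_self_eq_norm_sq, h₁₁ x hx]; norm_num
  have e22 : inner ℝ (e₂ x) (e₂ x) = 1 := by rw [real_inner_self_eq_norm_sq, h₂₂ x hx]; norm_num
  have hin : ∀ v w : TangentSpace 𝓘(ℝ, E) x, inner ℝ v w =
      inner ℝ v (e₁ x) * inner ℝ w (e₁ x) + inner ℝ v (e₂ x) * inner ℝ w (e₂ x) := fun v w => by
    conv_lhs => rw [eq_smul_add_smul_of_orthonormal hfin (h₁₁ x hx) (h₂₂ x hx) (h₁₂ x hx) w]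
    rw [inner_add_right, inner_smul_right, inner_smul_right]
    ring
  -- The Gram determinant in the denominator is the square of this coordinate determinant, which
  -- also divides the numerator twice.
  have hne : inner ℝ X (e₁ x) * inner ℝ Y (e₂ x) - inner ℝ X (e₂ x) * inner ℝ Y (e₁ x) ≠ 0 := by
    intro h0
    rw [LinearIndependent.pair_iff] at hXY
    have hz : ∀ s t : ℝ, s * inner ℝ X (e₁ x) + t * inner ℝ Y (e₁ x) = 0 →
        s * inner ℝ X (e₂ x) + t * inner ℝ Y (e₂ x) = 0 → s • X + t • Y = 0 := fun s t h1 h2 => by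
      have : s • X + t • Y = (s * inner ℝ X (e₁ x) + t * inner ℝ Y (e₁ x)) • e₁ x +
        (s * inner ℝ X (e₂ x) + t * inner ℝ Y (e₂ x)) • e₂ x := by
        conv_lhs => rw [hX, hY]
        module
      rw [this, h1, h2, zero_smul, zero_smul, add_zero]
    have z2 := hXY (inner ℝ Y (e₂ x)) (-inner ℝ X (e₂ x)) (hz _ _ (by linear_combination h0) (by ring))
    have z1 := hXY (inner ℝ Y (e₁ x)) (-inner ℝ X (e₁ x)) (hz _ _ (by ring) (by linear_combination -h0))
    have : Y = 0 := by rw [hY, z1.1, z2.1]; simp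
    have := hXY 0 1 (by simp [this])
    simp at this
  rw [hin X X, hin Y Y, hin X Y, inner_smul_left, inner_sub_left, inner_smul_left, inner_smul_left, real_inner_comm X,
    real_inner_comm X, div_eq_iff (by convert pow_ne_zero 2 hne using 1; ring)]
  simp
  ring
end

/-! ### Determinant in an orthonormal eigenbasis -/

section
variable {V : Type*} [NormedAddCommGroup V] [InnerProductSpace ℝ V]

theorem det_eq_mul_of_orthonormal (hV : Module.finrank ℝ V = 2) {e₁ e₂ : V}
    (h₁ : ‖e₁‖ = 1) (h₂ : ‖e₂‖ = 1) (h₁₂ : inner ℝ e₁ e₂ = 0) {A : V →ₗ[ℝ] V} {k₁ k₂ : ℝ}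
    (hk₁ : A e₁ = k₁ • e₁) (hk₂ : A e₂ = k₂ • e₂) : LinearMap.det A = k₁ * k₂ := by
  have ho : Orthonormal ℝ ![e₁, e₂] := by
    rw [orthonormal_iff_ite]
    intro i j
    fin_cases i <;> fin_cases j <;> simp [h₁, h₂, h₁₂, real_inner_comm e₁ e₂]
  let bs := basisOfLinearIndependentOfCardEqFinrank ho.linearIndependent (by simp [hV])
  have hbs : ⇑bs = ![e₁, e₂] := coe_basisOfLinearIndependentOfCardEqFinrank _ _
  have h : LinearMap.toMatrix bs bs A = Matrix.diagonal ![k₁, k₂] := by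
    rw [← LinearEquiv.eq_symm_apply, LinearMap.toMatrix_symm]
    refine bs.ext fun i => ?_
    rw [Matrix.toLin_self]
    fin_cases i <;> simp [hbs, hk₁, hk₂]
  rw [← LinearMap.det_toMatrix bs, h, Matrix.det_diagonal]
  simp
end

/-! ### Smooth local flows by the implicit function theorem on paths -/

set_option synthInstance.maxHeartbeats 200000
section
section
variable (K E E' : Type*) [TopologicalSpace K] [CompactSpace K] [NormedAddCommGroup E] [NormedSpace ℝ E]
  [NormedAddCommGroup E'] [NormedSpace ℝ E']

noncomputable local instance : NormedAddCommGroup C(K, E →L[ℝ] E') := inferInstance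
noncomputable local instance : SeminormedAddCommGroup C(K, E →L[ℝ] E') := inferInstance
noncomputable local instance : PseudoMetricSpace C(K, E →L[ℝ] E') := inferInstance

/-- Pointwise application of operator-valued functions to vector-valued functions. -/
noncomputable def pointwiseApply : C(K, E →L[ℝ] E') →L[ℝ] C(K, E) →L[ℝ] C(K, E') :=
  LinearMap.mkContinuous₂
    (LinearMap.mk₂ ℝ (fun (L : C(K, E →L[ℝ] E')) (γ : C(K, E)) => (⟨fun k => L k (γ k), by fun_prop⟩ : C(K, E')))
      (fun _ _ _ => by ext; simp) (fun _ _ _ => by ext; simp) (fun _ _ _ => by ext; simp)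
      (fun _ _ _ => by ext; simp)) 1 (fun (L : C(K, E →L[ℝ] E')) (γ : C(K, E)) => by
      rw [ContinuousMap.norm_le _ (by positivity)]
      intro k
      rw [one_mul]
      exact (L k).le_of_opNorm_le_of_le (L.norm_coe_le_norm k) (γ.norm_coe_le_norm k))

variable {K E E'}
@[simp] theorem pointwiseApply_apply (L : C(K, E →L[ℝ] E')) (γ : C(K, E)) (k : K) :
    pointwiseApply K E E' L γ k = L k (γ k) := rfl

/-- The mean value inequality at each `k` needs a bound on `X' y - X' (γ k)` that is uniform in `k`.
Continuity of `γ ↦ X' ∘ γ` in the sup norm supplies it, so `E` need not be locally compact. -/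
theorem hasFDerivAt_postcomp {X : C(E, E')} {X' : C(E, E →L[ℝ] E')} (hX : ∀ x, HasFDerivAt X (X' x) x)
    (γ : C(K, E)) :
    HasFDerivAt (fun γ : C(K, E) => X.comp γ) (pointwiseApply K E E' (X'.comp γ)) γ := by
  rw [hasFDerivAt_iff_isLittleO_nhds_zero, Asymptotics.isLittleO_iff]
  intro ε hε
  obtain ⟨δ, hδ, h⟩ := Metric.continuousAt_iff.1
    (ContinuousMap.continuous_postcomp (X := K) X').continuousAt ε hε
  filter_upwards [Metric.ball_mem_nhds (0 : C(K, E)) hδ] with η hη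
  rw [mem_ball_zero_iff] at hη
  rw [ContinuousMap.norm_le _ (by positivity)]
  intro k
  have hseg : ∀ y ∈ segment ℝ (γ k) (γ k + η k), ‖X' y - X' (γ k)‖ ≤ ε := by
    intro y hy
    rw [segment_eq_image'] at hy
    obtain ⟨t, ht, rfl⟩ := hy
    have h1 := h (x := γ + t • η) (by
      rw [dist_eq_norm, add_sub_cancel_left, norm_smul, Real.norm_of_nonneg ht.1]
      exact (mul_le_of_le_one_left (norm_nonneg _) ht.2).trans_lt hη)
    have h2 := (ContinuousMap.dist_apply_le_dist k).trans h1.le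
    rw [dist_eq_norm] at h2
    simpa using h2
  have := (convex_segment (γ k) (γ k + η k)).norm_image_sub_le_of_norm_hasFDerivWithin_le' (𝕜 := ℝ)
    (fun y _ => (hX y).hasFDerivWithinAt) hseg (left_mem_segment _ _ _) (right_mem_segment _ _ _)
  rw [add_sub_cancel_left] at this
  exact this.trans (mul_le_mul_of_nonneg_left (η.norm_coe_le_norm k) hε.le)
end


variable {K : Type*} [TopologicalSpace K] [CompactSpace K]

/-- The derivative is again a postcomposition, with `fderiv ℝ X`, followed by a bounded linear map;
hence induction on the order. The target must vary in the induction, and one universe contains both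
`E'` and `E →L[ℝ] E'`. -/
theorem contDiff_nat_postcomp {E : Type u} [NormedAddCommGroup E] [NormedSpace ℝ E] (n : ℕ) :
    ∀ {E' : Type u} [NormedAddCommGroup E'] [NormedSpace ℝ E'] {X : C(E, E')}, ContDiff ℝ n X →
      ContDiff ℝ n (fun γ : C(K, E) => X.comp γ) := by
  induction n with
  | zero =>
    intro E' _ _ X _
    exact contDiff_zero.2 (ContinuousMap.continuous_postcomp X)
  | succ n ih =>
    intro E' _ _ X hX
    have hX' : ContDiff ℝ n (fderiv ℝ X) := hX.fderiv_right (by norm_num)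
    have hd : ∀ x, HasFDerivAt X (fderiv ℝ X x) x := fun x => (hX.differentiable (by simp) x).hasFDerivAt
    refine contDiff_succ_iff_hasFDerivAt.2 ⟨fun γ => pointwiseApply K E E'
      ((⟨fderiv ℝ X, hX'.continuous⟩ : C(E, E →L[ℝ] E')).comp γ), ?_, fun γ => hasFDerivAt_postcomp hd γ⟩
    exact (pointwiseApply K E E').contDiff.comp (ih (X := ⟨fderiv ℝ X, hX'.continuous⟩) hX')

theorem contDiff_postcomp {E E' : Type u} [NormedAddCommGroup E] [NormedSpace ℝ E]
    [NormedAddCommGroup E'] [NormedSpace ℝ E'] {X : C(E, E')} (hX : ContDiff ℝ ∞ X) :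
    ContDiff ℝ ∞ (fun γ : C(K, E) => X.comp γ) :=
  contDiff_infty.2 fun n => contDiff_nat_postcomp n (contDiff_infty.1 hX n)
end

section
variable {E : Type*} [NormedAddCommGroup E] [NormedSpace ℝ E]

/-- The operator `γ ↦ ∫₀ᵗ γ` on paths. -/
noncomputable def pathIntegral (E : Type*) [NormedAddCommGroup E] [NormedSpace ℝ E] :
    C(Icc (0 : ℝ) 1, E) →L[ℝ] C(Icc (0 : ℝ) 1, E) :=
  LinearMap.mkContinuous
    { toFun γ := ⟨fun t => ∫ r in (0 : ℝ)..t, IccExtend zero_le_one γ r, by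
        have := intervalIntegral.continuous_primitive (μ := MeasureTheory.volume) (fun a b =>
          (γ.continuous.Icc_extend' (h := zero_le_one)).intervalIntegrable a b) (0 : ℝ)
        exact this.comp continuous_subtype_val⟩
      map_add' γ η := by
        ext t
        exact intervalIntegral.integral_add ((γ.continuous.Icc_extend' (h := zero_le_one)).intervalIntegrable _ _)
          ((η.continuous.Icc_extend' (h := zero_le_one)).intervalIntegrable _ _)
      map_smul' c γ := by
        ext t
        exact intervalIntegral.integral_smul c _ } 1 (fun γ => by
      rw [ContinuousMap.norm_le _ (by positivity)]
      intro t
      refine (intervalIntegral.norm_integral_le_of_norm_le_const (C := ‖γ‖) fun r _ => γ.norm_coe_le_norm _).trans ?_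
      rw [sub_zero, abs_of_nonneg t.2.1, one_mul]
      exact mul_le_of_le_one_right (norm_nonneg _) t.2.2)

theorem pathIntegral_apply (γ : C(Icc (0 : ℝ) 1, E)) (t : Icc (0 : ℝ) 1) :
    pathIntegral E γ t = ∫ r in (0 : ℝ)..t, IccExtend zero_le_one γ r := rfl

theorem hasDerivWithinAt_pathIntegral [CompleteSpace E] (γ : C(Icc (0 : ℝ) 1, E)) (t : Icc (0 : ℝ) 1) :
    HasDerivWithinAt (IccExtend zero_le_one (pathIntegral E γ)) (γ t) (Icc 0 1) t := by
  have h := intervalIntegral.integral_hasDerivAt_right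
    ((γ.continuous.Icc_extend' (h := zero_le_one)).intervalIntegrable (0 : ℝ) t)
    ((γ.continuous.Icc_extend' (h := zero_le_one)).stronglyMeasurableAtFilter _ _)
    (γ.continuous.Icc_extend' (h := zero_le_one)).continuousAt
  rw [IccExtend_val] at h
  refine h.hasDerivWithinAt.congr (fun r hr => ?_) ?_
  · rw [IccExtend_of_mem _ _ hr]; rfl
  · rw [IccExtend_val]; rfl

/-- Rescaling of a path. -/
def scalePath (r : Icc (0 : ℝ) 1) : C(Icc (0 : ℝ) 1, Icc (0 : ℝ) 1) := ⟨fun t => r * t, by fun_prop⟩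

theorem pathIntegral_comp_scalePath (γ : C(Icc (0 : ℝ) 1, E)) (r : Icc (0 : ℝ) 1) :
    (r : ℝ) • pathIntegral E (γ.comp (scalePath r)) = (pathIntegral E γ).comp (scalePath r) := by
  ext t
  rw [ContinuousMap.smul_apply, ContinuousMap.comp_apply, pathIntegral_apply, pathIntegral_apply]
  have : ∫ x in (0 : ℝ)..t, IccExtend zero_le_one (γ.comp (scalePath r)) x =
    ∫ x in (0 : ℝ)..t, IccExtend zero_le_one γ (r * x) := by
    refine intervalIntegral.integral_congr fun x hx => ?_
    rw [uIcc_of_le t.2.1] at hx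
    have hx' : x ∈ Icc (0 : ℝ) 1 := ⟨hx.1, hx.2.trans t.2.2⟩
    rw [IccExtend_of_mem _ _ hx', IccExtend_of_mem _ _ (x := (r : ℝ) * x) ⟨mul_nonneg r.2.1 hx'.1, mul_le_one₀ r.2.2 hx'.1 hx'.2⟩]
    rfl
  rw [this, intervalIntegral.smul_integral_comp_mul_left, mul_zero]
  rfl
end

/-- `ContDiffAt ℝ ∞` at one point only gives neighbourhoods depending on the order. But
invertibility of the partial derivative is an open condition, so the theorem applies afresh at each
nearby solution, and local uniqueness identifies the new implicit function with the old one. -/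
theorem eventually_contDiffAt_implicitFunction {E₁ E₂ F : Type*} [NormedAddCommGroup E₁] [NormedSpace ℝ E₁]
    [CompleteSpace E₁] [NormedAddCommGroup E₂] [NormedSpace ℝ E₂] [CompleteSpace E₂] [NormedAddCommGroup F]
    [NormedSpace ℝ F] [CompleteSpace F] {P : E₁ × E₂ → F} (hP : ContDiff ℝ ∞ P) {u : E₁ × E₂}
    (if₂ : (fderiv ℝ P u ∘L .inr ℝ E₁ E₂).IsInvertible) :
    ∀ᶠ x in 𝓝 u.1, ContDiffAt ℝ ∞ (hP.contDiffAt.implicitFunction (by simp) if₂) x := by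
  set Γ := hP.contDiffAt.implicitFunction (by simp) if₂ with hΓ
  have hΓ1 : ContDiffAt ℝ ∞ Γ u.1 := hP.contDiffAt.contDiffAt_implicitFunction (by simp) if₂
  have hΓu : Γ u.1 = u.2 := hP.contDiffAt.implicitFunction_apply_self (by simp) if₂
  have hsol : ∀ᶠ x in 𝓝 u.1, P (x, Γ x) = P u :=
    hP.contDiffAt.eventually_apply_implicitFunction (by simp) if₂
  have hcont : ∀ᶠ x in 𝓝 u.1, ContinuousAt Γ x := by
    filter_upwards [(hΓ1.of_le (m := 1) ENat.LEInfty.out).eventually (by simp)] with q hq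
    exact hq.continuousAt
  have hinv : ∀ᶠ x in 𝓝 u.1, (fderiv ℝ P (x, Γ x) ∘L .inr ℝ E₁ E₂).IsInvertible := by
    have h1 : ContinuousAt (fun x => fderiv ℝ P (x, Γ x) ∘L .inr ℝ E₁ E₂) u.1 := by
      have h2 : Continuous (fderiv ℝ P) := hP.continuous_fderiv (by simp)
      have h3 : ContinuousAt (fun x => fderiv ℝ P (x, Γ x)) u.1 :=
        h2.continuousAt.comp (continuousAt_id.prodMk hΓ1.continuousAt)
      exact h3.clm_comp continuousAt_const
    obtain ⟨e, he⟩ := if₂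
    have h4 := ContinuousLinearEquiv.nhds e
    rw [he] at h4
    refine h1.eventually ?_
    beta_reduce
    rw [hΓu]
    filter_upwards [h4] with L hL
    exact hL
  filter_upwards [hsol.eventually_nhds, hsol, hcont, hinv] with x hx hx0 hxc hxi
  have hx' := hP.contDiffAt.eventually_apply_eq_iff_implicitFunction (n := ∞) (by simp) hxi
  refine (hP.contDiffAt.contDiffAt_implicitFunction (n := ∞) (by simp) hxi).congr_of_eventuallyEq ?_
  have h5 : Filter.Tendsto (fun y => (y, Γ y)) (𝓝 x) (𝓝 (x, Γ x)) := continuousAt_id.prodMk hxc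
  filter_upwards [h5.eventually hx', hx] with y hy hy1
  exact (hy.1 (hy1.trans hx0.symm)).symm

section
variable {E : Type u} [NormedAddCommGroup E] [NormedSpace ℝ E] [CompleteSpace E]

/-- A smooth vector field has a smooth local flow. -/
theorem exists_smooth_flow_of_contDiff {X : E → E} (hX : ContDiff ℝ ∞ X) (x₀ : E) :
    ∃ Φ : ℝ × E → E, (∀ᶠ q in 𝓝 ((0 : ℝ), x₀), ContDiffAt ℝ ∞ Φ q) ∧ (∀ᶠ x in 𝓝 x₀, Φ (0, x) = x) ∧
      ∀ᶠ q in 𝓝 ((0 : ℝ), x₀), HasDerivAt (fun s => Φ (s, q.2)) (X (Φ q)) q.1 := by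
  let cst : E →L[ℝ] C(Icc (0 : ℝ) 1, E) := LinearMap.mkContinuous
    { toFun x := ContinuousMap.const _ x, map_add' _ _ := rfl, map_smul' _ _ := rfl } 1 (fun x => by
      rw [ContinuousMap.norm_le _ (by positivity)]
      intro t
      rw [one_mul]
      rfl)
  let Xc : C(E, E) := ⟨X, hX.continuous⟩
  -- A zero `γ` of `P` at `(s, x)` is the integral curve from `x` with time rescaled from `[0, s]`
  -- to `[0, 1]`, so the flow at time `s` is `γ 1`.
  let P : (ℝ × E) × C(Icc (0 : ℝ) 1, E) → C(Icc (0 : ℝ) 1, E) := fun q =>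
    q.2 - cst q.1.2 - q.1.1 • pathIntegral E (Xc.comp q.2)
  have hPs : ContDiff ℝ ∞ P := by
    have h1 : ContDiff ℝ ∞ fun q : (ℝ × E) × C(Icc (0 : ℝ) 1, E) => Xc.comp q.2 :=
      (contDiff_postcomp hX).comp contDiff_snd
    exact (contDiff_snd.sub (cst.contDiff.comp (contDiff_snd.comp contDiff_fst))).sub
      ((contDiff_fst.comp contDiff_fst).smul ((pathIntegral E).contDiff.comp h1))
  let u : (ℝ × E) × C(Icc (0 : ℝ) 1, E) := ((0, x₀), cst x₀)
  have hPu : P u = 0 := by simp [P, u]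
  -- At `s = 0` the integral term is absent, so `P` is a translation in `γ`.
  have hinv : (fderiv ℝ P u ∘L .inr ℝ (ℝ × E) C(Icc (0 : ℝ) 1, E)) = ContinuousLinearMap.id ℝ _ := by
    have h1 : HasFDerivAt (fun γ => P (u.1, γ)) (fderiv ℝ P u ∘L .inr ℝ (ℝ × E) C(Icc (0 : ℝ) 1, E)) u.2 :=
      ((hPs.differentiable (by simp) u).hasFDerivAt).comp u.2 (hasFDerivAt_prodMk_right u.1 u.2)
    have h2 : (fun γ => P (u.1, γ)) = fun γ => γ - cst x₀ := by
      funext γ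
      simp [P, u]
    rw [h2] at h1
    exact h1.unique ((hasFDerivAt_id _).sub_const _)
  have if₂ : (fderiv ℝ P u ∘L .inr ℝ (ℝ × E) C(Icc (0 : ℝ) 1, E)).IsInvertible := by
    rw [hinv]
    exact ContinuousLinearMap.isInvertible_equiv (f := ContinuousLinearEquiv.refl ℝ _)
  have cdf : ContDiffAt ℝ ∞ P u := hPs.contDiffAt
  let Γ := cdf.implicitFunction (by simp) if₂
  have hΓs : ∀ᶠ q in 𝓝 ((0 : ℝ), x₀), ContDiffAt ℝ ∞ Γ q := eventually_contDiffAt_implicitFunction hPs if₂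
  have hΓu : Γ (0, x₀) = cst x₀ := cdf.implicitFunction_apply_self (by simp) if₂
  have hiff : ∀ᶠ v in 𝓝 u, P v = P u ↔ Γ v.1 = v.2 := cdf.eventually_apply_eq_iff_implicitFunction (by simp) if₂
  have hΓd : ∀ᶠ q in 𝓝 ((0 : ℝ), x₀), DifferentiableAt ℝ Γ q := by
    filter_upwards [hΓs] with q hq
    exact hq.differentiableAt (by simp)
  obtain ⟨ε, hε, hball⟩ := Metric.eventually_nhds_iff_ball.1 hiff
  have hΓc : ∀ᶠ q in 𝓝 ((0 : ℝ), x₀), Γ q ∈ Metric.ball (cst x₀) ε := by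
    have := hΓs.self_of_nhds.continuousAt
    rw [ContinuousAt, hΓu] at this
    exact this (Metric.ball_mem_nhds _ hε)
  obtain ⟨δ', hδ', hball'⟩ := Metric.eventually_nhds_iff_ball.1 (hΓc.and hΓd)
  obtain ⟨δ, hδ, hδε, hδδ⟩ : ∃ δ > 0, δ ≤ ε ∧ δ ≤ δ' := ⟨min ε δ', lt_min hε hδ', min_le_left _ _, min_le_right _ _⟩
  have hmem : ∀ (s : ℝ) (x : E), |s| < δ → dist x x₀ < δ → (s, x) ∈ Metric.ball ((0 : ℝ), x₀) δ := by
    intro s x hs hx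
    rw [Metric.mem_ball, Prod.dist_eq, max_lt_iff, Real.dist_0_eq_abs]
    exact ⟨hs, hx⟩
  have hsol : ∀ (s : ℝ) (x : E) γ, |s| < δ → dist x x₀ < δ → γ ∈ Metric.ball (cst x₀) ε →
      (γ - cst x - s • pathIntegral E (Xc.comp γ) = 0 ↔ Γ (s, x) = γ) := by
    intro s x γ hs hx hγ
    have := hball ((s, x), γ) (by
      rw [Metric.mem_ball, Prod.dist_eq, max_lt_iff]
      exact ⟨(hmem s x hs hx).out.trans_le hδε, hγ⟩)
    rwa [hPu] at this
  have heq : ∀ (s : ℝ) (x : E), |s| < δ → dist x x₀ < δ →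
      Γ (s, x) = cst x + s • pathIntegral E (Xc.comp (Γ (s, x))) := by
    intro s x hs hx
    have := (hsol s x (Γ (s, x)) hs hx (hball' _ (Metric.ball_subset_ball hδδ (hmem s x hs hx))).1).2 rfl
    rwa [sub_sub, sub_eq_zero] at this
  have hpt : ∀ (s : ℝ) (x : E) (t : Icc (0 : ℝ) 1), |s| < δ → dist x x₀ < δ →
      Γ (s, x) t = x + s • pathIntegral E (Xc.comp (Γ (s, x))) t := fun s x t hs hx =>
    DFunLike.congr_fun (heq s x hs hx) t
  -- The rescaled path solves the equation for time `r * s` and stays in the same ball, as it takes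
  -- no new values; uniqueness in the ball then applies. This makes the endpoint map trace one
  -- integral curve.
  have hscale : ∀ (s : ℝ) (x : E) (r : Icc (0 : ℝ) 1), |s| < δ → dist x x₀ < δ →
      Γ (r * s, x) = (Γ (s, x)).comp (scalePath r) := by
    intro s x r hs hx
    have hrs : |r * s| < δ := by
      rw [abs_mul, abs_of_nonneg r.2.1]
      exact (mul_le_of_le_one_left (abs_nonneg _) r.2.2).trans_lt hs
    refine (hsol _ x _ hrs hx ?_).1 ?_
    · have := (hball' _ (Metric.ball_subset_ball hδδ (hmem s x hs hx))).1
      rw [Metric.mem_ball] at this ⊢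
      refine lt_of_le_of_lt ?_ this
      rw [ContinuousMap.dist_le dist_nonneg]
      intro t
      exact ContinuousMap.dist_apply_le_dist (f := Γ (s, x)) (g := cst x₀) (scalePath r t)
    · rw [← ContinuousMap.comp_assoc, mul_comm, mul_smul, pathIntegral_comp_scalePath]
      ext t
      change Γ (s, x) (scalePath r t) - x - s • pathIntegral E (Xc.comp (Γ (s, x))) (scalePath r t) = 0
      rw [hpt s x _ hs hx]
      abel
  let ev : C(Icc (0 : ℝ) 1, E) →L[ℝ] E := ContinuousMap.evalCLM ℝ 1
  have hΦr : ∀ (s : ℝ) (x : E) (r : Icc (0 : ℝ) 1), |s| < δ → dist x x₀ < δ → ev (Γ (r * s, x)) = Γ (s, x) r := by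
    intro s x r hs hx
    rw [hscale s x r hs hx]
    change Γ (s, x) (scalePath r 1) = _
    congr 1
    exact Subtype.ext (mul_one _)
  -- Comparing derivatives in `r` produces a factor `s` that has to be cancelled. Keeping `r` free
  -- still reaches time `0`, as `r = 0` with `s = δ / 2`.
  have hder : ∀ (s : ℝ) (x : E) (r : Icc (0 : ℝ) 1), s ≠ 0 → |s| < δ → dist x x₀ < δ →
      HasDerivAt (fun t => ev (Γ (t, x))) (X (ev (Γ (r * s, x)))) (r * s) := by
    intro s x r hs0 hs hx
    have hrs : |r * s| < δ := by
      rw [abs_mul, abs_of_nonneg r.2.1]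
      exact (mul_le_of_le_one_left (abs_nonneg _) r.2.2).trans_lt hs
    have hd : DifferentiableAt ℝ (fun t => ev (Γ (t, x))) (r * s) := by
      have h1 := (hball' _ (Metric.ball_subset_ball hδδ (hmem _ x hrs hx))).2
      have h2 : DifferentiableAt ℝ (fun t : ℝ => (t, x)) (r * s) := by fun_prop
      exact ev.differentiableAt.comp _ (DifferentiableAt.comp (r * s : ℝ) h1 h2)
    have h1 : HasDerivWithinAt (fun t : ℝ => ev (Γ (t * s, x))) (s • deriv (fun t => ev (Γ (t, x))) (r * s)) (Icc 0 1) r :=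
      (HasDerivAt.scomp (h := fun t : ℝ => t * s) (r : ℝ) hd.hasDerivAt
        (by simpa using (hasDerivAt_id (r : ℝ)).mul_const s)).hasDerivWithinAt
    have h2 : HasDerivWithinAt (fun t : ℝ => ev (Γ (t * s, x))) (s • X (Γ (s, x) r)) (Icc 0 1) r := by
      have h3 := ((hasDerivWithinAt_pathIntegral (Xc.comp (Γ (s, x))) r).const_smul s).const_add x
      refine h3.congr (fun t ht => ?_) ?_
      · rw [hΦr s x ⟨t, ht⟩ hs hx, hpt s x _ hs hx, Pi.smul_apply, IccExtend_of_mem _ _ ht]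
      · rw [hΦr s x r hs hx, hpt s x _ hs hx, Pi.smul_apply, IccExtend_val]
    have h4 := (uniqueDiffOn_Icc (zero_lt_one (α := ℝ)) r r.2).eq_deriv _ h1 h2
    rw [hΦr s x r hs hx, ← smul_right_injective E hs0 h4]
    exact hd.hasDerivAt
  refine ⟨fun q => ev (Γ q), hΓs.mono fun q hq => ev.contDiff.contDiffAt.comp _ hq, ?_, ?_⟩
  · filter_upwards [Metric.ball_mem_nhds x₀ hδ] with x hx
    rw [heq 0 x (by simpa using hδ) hx, zero_smul, add_zero]
    rfl
  · filter_upwards [Metric.ball_mem_nhds ((0 : ℝ), x₀) hδ] with q hq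
    obtain ⟨s, x⟩ := q
    rw [Metric.mem_ball, Prod.dist_eq, max_lt_iff, Real.dist_0_eq_abs] at hq
    rcases eq_or_ne s 0 with rfl | h0
    · have := hder (δ / 2) x 0 (by positivity) (by rw [abs_of_pos (by positivity)]; linarith) hq.2
      simpa only [Icc.coe_zero, zero_mul] using this
    · have := hder s x 1 h0 hq.1 hq.2
      simpa only [Icc.coe_one, one_mul] using this

/-- Multiply the field by a bump function supported inside `Ω` and equal to `1` near `x₀`; for short
times the flow stays where nothing was changed. -/
theorem exists_smooth_flow [FiniteDimensional ℝ E] {X : E → E} {Ω : Set E} (hΩ : IsOpen Ω)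
    (hX : ContDiffOn ℝ ∞ X Ω) {x₀ : E} (hx₀ : x₀ ∈ Ω) :
    ∃ Φ : ℝ × E → E, (∀ᶠ q in 𝓝 ((0 : ℝ), x₀), ContDiffAt ℝ ∞ Φ q) ∧ (∀ᶠ x in 𝓝 x₀, Φ (0, x) = x) ∧
      ∀ᶠ q in 𝓝 ((0 : ℝ), x₀), HasDerivAt (fun s => Φ (s, q.2)) (X (Φ q)) q.1 := by
  obtain ⟨r, hr, hrΩ⟩ := Metric.nhds_basis_closedBall.mem_iff.1 (hΩ.mem_nhds hx₀)
  let χ : ContDiffBump x₀ := ⟨r / 2, r, by positivity, by linarith⟩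
  have hs : ContDiff ℝ ∞ (fun x => χ x • X x) := by
    refine contDiff_iff_contDiffAt.2 fun x => ?_
    by_cases hx : x ∈ tsupport χ
    · rw [χ.tsupport_eq] at hx
      exact χ.contDiff.contDiffAt.smul (hX.contDiffAt (hΩ.mem_nhds (hrΩ hx)))
    · refine (contDiffAt_const (c := 0)).congr_of_eventuallyEq ?_
      filter_upwards [notMem_tsupport_iff_eventuallyEq.1 hx] with y hy
      rw [show χ y = 0 from hy, zero_smul]
  obtain ⟨Φ, h1, h2, h3⟩ := exists_smooth_flow_of_contDiff hs x₀
  refine ⟨Φ, h1, h2, ?_⟩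
  have h4 := h1.self_of_nhds.continuousAt
  rw [ContinuousAt, h2.self_of_nhds] at h4
  filter_upwards [h3, h4 χ.eventuallyEq_one] with q hq hq1
  simpa [show χ (Φ q) = 1 from hq1] using hq
end

/-! ### Coordinates adapted to the frame -/

section
variable {E : Type u} [NormedAddCommGroup E] [NormedSpace ℝ E] [FiniteDimensional ℝ E]

/-- `G (s, t)` runs along `Y` for time `t` from `p`, then along `X` for time `s`. The derivative in
`t` is claimed only on the axis `s = 0`; off it, the bracket relation is needed. -/
theorem exists_flow_map {X Y : E → E} {Ω : Set E} (hΩ : IsOpen Ω) (hX : ContDiffOn ℝ ∞ X Ω)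
    (hY : ContDiffOn ℝ ∞ Y Ω) {p : E} (hp : p ∈ Ω) :
    ∃ G : ℝ × ℝ → E, G (0, 0) = p ∧ ∀ᶠ q in 𝓝 ((0 : ℝ), (0 : ℝ)), ContDiffAt ℝ ∞ G q ∧
      HasDerivAt (fun s => G (s, q.2)) (X (G q)) q.1 ∧ HasDerivAt (fun t => G (0, t)) (Y (G (0, q.2))) q.2 := by
  have : CompleteSpace E := FiniteDimensional.complete ℝ E
  obtain ⟨Φ, f1, f2, f3⟩ := exists_smooth_flow hΩ hX hp
  obtain ⟨Ψ, g1, g2, g3⟩ := exists_smooth_flow hΩ hY hp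
  have hj : Continuous fun t : ℝ => (t, p) := by fun_prop
  have hjt : Filter.Tendsto (fun t : ℝ => (t, p)) (𝓝 0) (𝓝 (0, p)) := hj.tendsto 0
  have hΨ0 : Ψ (0, p) = p := g2.self_of_nhds
  have k1 : ∀ᶠ t in 𝓝 (0 : ℝ), ContDiffAt ℝ ∞ (fun t => Ψ (t, p)) t := by
    filter_upwards [hjt.eventually g1] with t ht
    exact ContDiffAt.comp t ht (contDiffAt_id.prodMk contDiffAt_const)
  have hΨt : Filter.Tendsto (fun t => Ψ (t, p)) (𝓝 0) (𝓝 p) := by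
    have := k1.self_of_nhds.continuousAt
    rwa [ContinuousAt, hΨ0] at this
  have hsnd : Filter.Tendsto (fun q : ℝ × ℝ => q.2) (𝓝 (0, 0)) (𝓝 0) := continuous_snd.tendsto _
  have hfst : Filter.Tendsto (fun q : ℝ × ℝ => q.1) (𝓝 (0, 0)) (𝓝 0) := continuous_fst.tendsto _
  have hin : Filter.Tendsto (fun q : ℝ × ℝ => (q.1, Ψ (q.2, p))) (𝓝 (0, 0)) (𝓝 (0, p)) := by
    rw [nhds_prod_eq (x := (0 : ℝ)) (y := p)]
    exact hfst.prodMk (hΨt.comp hsnd)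
  refine ⟨fun q => Φ (q.1, Ψ (q.2, p)), by simp only [hΨ0]; exact f2.self_of_nhds, ?_⟩
  filter_upwards [hsnd.eventually k1, hin.eventually f1, hin.eventually f3, hsnd.eventually (hjt.eventually g3),
    hsnd.eventually (hΨt.eventually f2).eventually_nhds] with q a1 a2 a3 a4 a5
  refine ⟨?_, a3, ?_⟩
  · exact ContDiffAt.comp q a2 (contDiffAt_fst.prodMk (ContDiffAt.comp (g := fun t => Ψ (t, p)) q a1 contDiffAt_snd))
  · have h0 : (fun t => Φ (0, Ψ (t, p))) =ᶠ[𝓝 q.2] fun t => Ψ (t, p) := a5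
    change HasDerivAt (fun t => Φ (0, Ψ (t, p))) (Y (Φ (0, Ψ (q.2, p)))) q.2
    rw [a5.self_of_nhds]
    exact a4.congr_of_eventuallyEq h0

set_option maxHeartbeats 1000000 in
-- Along each `X`-curve, `∂ₜG` and `β Y` satisfy the same linear equation `w' = DX(w)` with the same
-- value at `s = 0`, so they coincide.
theorem exists_adapted_map {X Y : E → E} {b : E → ℝ} {Ω : Set E} (hΩ : IsOpen Ω) (hX : ContDiffOn ℝ ∞ X Ω)
    (hY : ContDiffOn ℝ ∞ Y Ω) (hb : ContinuousOn b Ω) (hXY : ∀ x ∈ Ω, lieBracket ℝ X Y x = -(b x • Y x))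
    {p : E} (hp : p ∈ Ω) :
    ∃ (G : ℝ × ℝ → E) (δ : ℝ), 0 < δ ∧ G (0, 0) = p ∧ ∀ q ∈ Ioo (-δ) δ ×ˢ Ioo (-δ) δ, G q ∈ Ω ∧
      ContDiffAt ℝ ∞ G q ∧ HasFDerivAt G ((ContinuousLinearMap.fst ℝ ℝ ℝ).smulRight (X (G q)) +
        (ContinuousLinearMap.snd ℝ ℝ ℝ).smulRight (Real.exp (∫ r in (0 : ℝ)..q.1, b (G (r, q.2))) • Y (G q))) q := by
  obtain ⟨G, hG0, hG⟩ := exists_flow_map hΩ hX hY hp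
  have hGc : Filter.Tendsto G (𝓝 (0, 0)) (𝓝 p) := by
    have := hG.self_of_nhds.1.continuousAt
    rwa [ContinuousAt, hG0] at this
  have hX' : ContinuousAt (fun x => ‖fderiv ℝ X x‖) p :=
    ((hX.continuousOn_fderiv_of_isOpen hΩ (by simp)).continuousAt (hΩ.mem_nhds hp)).norm
  have hbd : ∀ᶠ x in 𝓝 p, ‖fderiv ℝ X x‖ ≤ ‖fderiv ℝ X p‖ + 1 :=
    (hX'.eventually (gt_mem_nhds (lt_add_one _))).mono fun _ h => h.le
  obtain ⟨δ, hδ, hball⟩ := Metric.eventually_nhds_iff_ball.1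
    (hG.and ((hGc.eventually (hΩ.mem_nhds hp)).and (hGc.eventually hbd)))
  have hQ : ∀ q ∈ Ioo (-δ) δ ×ˢ Ioo (-δ) δ, q ∈ Metric.ball ((0 : ℝ), (0 : ℝ)) δ := by
    intro q hq
    rw [← ball_prod_same, Real.ball_eq_Ioo]
    simpa using hq
  refine ⟨G, δ, hδ, hG0, fun q hq => ?_⟩
  obtain ⟨⟨hs, -, -⟩, hqΩ, -⟩ := hball q (hQ q hq)
  refine ⟨hqΩ, hs, ?_⟩
  obtain ⟨s, t⟩ := q
  obtain ⟨hs, ht⟩ : s ∈ Ioo (-δ) δ ∧ t ∈ Ioo (-δ) δ := hq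
  have hm : ∀ r ∈ Ioo (-δ) δ, (r, t) ∈ Ioo (-δ) δ ×ˢ Ioo (-δ) δ := fun r hr => ⟨hr, ht⟩
  have h0 : (0 : ℝ) ∈ Ioo (-δ) δ := ⟨by linarith, hδ⟩
  have hGs : ∀ r ∈ Ioo (-δ) δ, ContDiffAt ℝ ∞ G (r, t) := fun r hr => (hball _ (hQ _ (hm r hr))).1.1
  have hGd : ∀ r ∈ Ioo (-δ) δ, DifferentiableAt ℝ G (r, t) := fun r hr => (hGs r hr).differentiableAt (by simp)
  have hGΩ : ∀ r ∈ Ioo (-δ) δ, G (r, t) ∈ Ω := fun r hr => (hball _ (hQ _ (hm r hr))).2.1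
  have hline : ∀ r, HasDerivAt (fun r : ℝ => (r, t)) ((1 : ℝ), (0 : ℝ)) r := fun r =>
    (hasDerivAt_id r).prodMk (hasDerivAt_const r t)
  have hfst : ∀ q ∈ Metric.ball ((0 : ℝ), (0 : ℝ)) δ, fderiv ℝ G q (1, 0) = X (G q) := fun q hq => by
    obtain ⟨⟨a1, a2, -⟩, -, -⟩ := hball q hq
    have := (a1.differentiableAt (by simp)).hasFDerivAt.comp_hasDerivAt q.1
      ((hasDerivAt_id q.1).prodMk (hasDerivAt_const q.1 q.2))
    exact this.unique a2
  have hGder : ∀ r ∈ Ioo (-δ) δ, HasDerivAt (fun r => G (r, t)) (X (G (r, t))) r := fun r hr =>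
    (hball _ (hQ _ (hm r hr))).1.2.1
  set β : ℝ → ℝ := fun s => Real.exp (∫ r in (0 : ℝ)..s, b (G (r, t))) with hβ
  have hbc : ContinuousOn (fun r => b (G (r, t))) (Ioo (-δ) δ) :=
    hb.comp (fun r hr => (hGder r hr).continuousAt.continuousWithinAt) hGΩ
  have hβd : ∀ r ∈ Ioo (-δ) δ, HasDerivAt β (β r * b (G (r, t))) r := fun r hr => by
    have hsub : uIcc 0 r ⊆ Ioo (-δ) δ := (convex_Ioo (-δ) δ).ordConnected.uIcc_subset h0 hr
    exact (intervalIntegral.integral_hasDerivAt_right ((hbc.mono hsub).intervalIntegrable)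
      (hbc.stronglyMeasurableAtFilter isOpen_Ioo r hr) (hbc.continuousAt (isOpen_Ioo.mem_nhds hr))).exp
  -- The variational equation: swap the mixed second derivatives of `G` and differentiate `∂ₛG = X ∘
  -- G` in `t`.
  have hD : ∀ r ∈ Ioo (-δ) δ, HasDerivAt (fun r => fderiv ℝ G (r, t) (0, 1))
      (fderiv ℝ X (G (r, t)) (fderiv ℝ G (r, t) (0, 1))) r := fun r hr => by
    have hd2 : DifferentiableAt ℝ (fderiv ℝ G) (r, t) :=
      ((hGs r hr).fderiv_right (m := 1) (one_add_one_eq_two.trans_le ENat.LEInfty.out)).differentiableAt (by simp)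
    have h1 := (hd2.hasFDerivAt.comp_hasDerivAt r (hline r)).clm_apply (hasDerivAt_const r ((0 : ℝ), (1 : ℝ)))
    rw [map_zero, add_zero, (hGs r hr).isSymmSndFDerivAt (by rw [minSmoothness_of_isRCLikeNormedField]; exact ENat.LEInfty.out)] at h1
    refine HasDerivAt.congr_deriv h1 ?_
    have h2 : (fun q => fderiv ℝ G q (1, 0)) =ᶠ[𝓝 (r, t)] X ∘ G := by
      filter_upwards [Metric.isOpen_ball.mem_nhds (hQ _ (hm r hr))] with q hq
      exact hfst q hq
    have h3 := (hd2.hasFDerivAt.clm_apply (hasFDerivAt_const ((1 : ℝ), (0 : ℝ)) (r, t))).congr_of_eventuallyEq h2.symm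
    have h4 := ((hX.contDiffAt (hΩ.mem_nhds (hGΩ r hr))).differentiableAt (by simp)).hasFDerivAt.comp (r, t)
      (hGd r hr).hasFDerivAt
    have h5 := DFunLike.congr_fun (h4.unique h3) (0, 1)
    simpa using h5.symm
  -- The bracket relation reads `DY(X) = DX(Y) - b Y`, and `β' = b β` is what cancels the extra
  -- term.
  have hE : ∀ r ∈ Ioo (-δ) δ, HasDerivAt (fun r => β r • Y (G (r, t)))
      (fderiv ℝ X (G (r, t)) (β r • Y (G (r, t)))) r := fun r hr => by
    have h1 := ((hY.contDiffAt (hΩ.mem_nhds (hGΩ r hr))).differentiableAt (by simp)).hasFDerivAt.comp_hasDerivAt r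
      (hGder r hr)
    have h2 := hXY _ (hGΩ r hr)
    rw [lieBracket, sub_eq_iff_eq_add] at h2
    rw [h2] at h1
    refine HasDerivAt.congr_deriv ((hβd r hr).smul h1) ?_
    rw [map_smul]
    module
  have hD0 : fderiv ℝ G (0, t) (0, 1) = β 0 • Y (G (0, t)) := by
    have h1 := (hGd 0 h0).hasFDerivAt.comp_hasDerivAt t ((hasDerivAt_const t (0 : ℝ)).prodMk (hasDerivAt_id t))
    rw [h1.unique (hball _ (hQ _ (hm 0 h0))).1.2.2]
    simp [hβ]
  -- The Lipschitz constant is the bound on `‖DX‖` near `p` that was built into the choice of `δ`.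
  have hunique := ODE_solution_unique_of_mem_Ioo (v := fun r w => fderiv ℝ X (G (r, t)) w) (s := fun _ => univ)
    (K := ⟨‖fderiv ℝ X p‖ + 1, by positivity⟩)
    (fun r hr => ((fderiv ℝ X (G (r, t))).lipschitz.weaken (hball _ (hQ _ (hm r hr))).2.2).lipschitzOnWith) h0
    (fun r hr => ⟨hD r hr, mem_univ _⟩) (fun r hr => ⟨hE r hr, mem_univ _⟩) hD0 hs
  convert (hGd s hs).hasFDerivAt using 1
  refine ContinuousLinearMap.ext fun ⟨u, v⟩ => ?_
  have : (u, v) = u • ((1 : ℝ), (0 : ℝ)) + v • ((0 : ℝ), (1 : ℝ)) := by simp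
  rw [this, map_add, map_add, map_smul, map_smul, map_smul, map_smul, hfst _ (hQ _ (hm s hs))]
  simp only at hunique
  rw [hunique]
  simp [hβ]
end

section
variable {E : Type*} [NormedAddCommGroup E] [NormedSpace ℝ E]
  {M : Type*} [TopologicalSpace M] [ChartedSpace E M] [IsManifold 𝓘(ℝ, E) ∞ M]

theorem contDiffAt_chartField {x : M} {X : (y : M) → TangentSpace 𝓘(ℝ, E) y} {y : M} (hy : y ∈ (chartAt E x).source)
    (hX : ContMDiffAt 𝓘(ℝ, E) 𝓘(ℝ, E).tangent ∞ (fun y => (⟨y, X y⟩ : TangentBundle 𝓘(ℝ, E) M)) y) :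
    ContDiffAt ℝ ∞ (chartField x X) (extChartAt 𝓘(ℝ, E) x y) := by
  have hy' : y ∈ (extChartAt 𝓘(ℝ, E) x).source := by simpa using hy
  have h1 := ((trivializationAt E (TangentSpace 𝓘(ℝ, E)) x).contMDiffAt_section_iff (n := ∞) (s := X) (IB := 𝓘(ℝ, E)) (by simpa using hy)).1 hX
  have h4 := contMDiffWithinAt_extChartAt_symm_range (I := 𝓘(ℝ, E)) (n := ∞) x ((extChartAt 𝓘(ℝ, E) x).map_source hy')
  simp only [modelWithCornersSelf_coe, range_id, contMDiffWithinAt_univ] at h4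
  rw [← contMDiffAt_iff_contDiffAt]
  have h5 := ContMDiffAt.comp (extChartAt 𝓘(ℝ, E) x y) (by rwa [(extChartAt 𝓘(ℝ, E) x).left_inv hy']) h4
  refine h5.congr_of_eventuallyEq ?_
  filter_upwards [(isOpen_extChartAt_target x).mem_nhds ((extChartAt 𝓘(ℝ, E) x).map_source hy')] with z hz
  simp only [Function.comp_apply]
  have hz' := (extChartAt 𝓘(ℝ, E) x).map_target hz
  rw [trivializationAt_apply_snd (by simpa using hz')]
  rfl

theorem mfderiv_chartAt_symm_chartField (x : M) (X : (y : M) → TangentSpace 𝓘(ℝ, E) y) {w : E}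
    (hw : w ∈ (chartAt E x).target) :
    mfderiv 𝓘(ℝ, E) 𝓘(ℝ, E) (chartAt E x).symm w (chartField (E := E) x X w) = X ((chartAt E x).symm w) := by
  have h1 := mfderivWithin_extChartAt_symm_comp_mfderiv_extChartAt (I := 𝓘(ℝ, E)) (x := x) (y := w) (by simpa using hw)
  simp only [modelWithCornersSelf_coe, range_id, mfderivWithin_univ] at h1
  exact DFunLike.congr_fun h1 _
end

/-- The inverse function theorem at the origin, cut down to a square. Linear independence throughout
the square makes the inverse smooth on the whole image, not just near one point. -/
theorem exists_openPartialHomeomorph_of_rectangle {G : ℝ × ℝ → EuclideanSpace ℝ (Fin 2)} {δ : ℝ} (hδ : 0 < δ)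
    {X Y : ℝ × ℝ → EuclideanSpace ℝ (Fin 2)} (hG : ∀ q ∈ Ioo (-δ) δ ×ˢ Ioo (-δ) δ, ContDiffAt ℝ ∞ G q ∧
      HasFDerivAt G ((ContinuousLinearMap.fst ℝ ℝ ℝ).smulRight (X q) + (ContinuousLinearMap.snd ℝ ℝ ℝ).smulRight (Y q)) q ∧
      LinearIndependent ℝ ![X q, Y q]) :
    ∃ (h : OpenPartialHomeomorph (EuclideanSpace ℝ (Fin 2)) (EuclideanSpace ℝ (Fin 2))) (r : ℝ), 0 < r ∧ r ≤ δ ∧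
      h.source = {z | z 0 ∈ Ioo (-r) r ∧ z 1 ∈ Ioo (-r) r} ∧ (⇑h = fun z => G (z 0, z 1)) ∧
      ContDiffOn ℝ ∞ h h.source ∧ ContDiffOn ℝ ∞ h.symm h.target ∧
      ∀ z ∈ h.source, ∀ v, fderiv ℝ h z v = v 0 • X (z 0, z 1) + v 1 • Y (z 0, z 1) := by
  let c : EuclideanSpace ℝ (Fin 2) →L[ℝ] ℝ × ℝ :=
    (EuclideanSpace.proj (0 : Fin 2)).prod (EuclideanSpace.proj (1 : Fin 2))
  let g : EuclideanSpace ℝ (Fin 2) → EuclideanSpace ℝ (Fin 2) := fun z => G (c z)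
  have hsm : ∀ z, c z ∈ Ioo (-δ) δ ×ˢ Ioo (-δ) δ → ContDiffAt ℝ ∞ g z := fun z hz =>
    (hG _ hz).1.comp z c.contDiff.contDiffAt
  have hd : ∀ z, c z ∈ Ioo (-δ) δ ×ˢ Ioo (-δ) δ → ∃ L : EuclideanSpace ℝ (Fin 2) ≃L[ℝ] EuclideanSpace ℝ (Fin 2),
      HasFDerivAt g (L : EuclideanSpace ℝ (Fin 2) →L[ℝ] EuclideanSpace ℝ (Fin 2)) z ∧
      ∀ v, L v = v 0 • X (z 0, z 1) + v 1 • Y (z 0, z 1) := by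
    intro z hz
    obtain ⟨-, h1, h2⟩ := hG _ hz
    have h3 := h1.comp z c.hasFDerivAt
    set A := ((ContinuousLinearMap.fst ℝ ℝ ℝ).smulRight (X (c z)) +
      (ContinuousLinearMap.snd ℝ ℝ ℝ).smulRight (Y (c z))) ∘L c with hA
    have hAv : ∀ v, A v = v 0 • X (z 0, z 1) + v 1 • Y (z 0, z 1) := fun v => rfl
    have hinj : Function.Injective A := by
      rw [injective_iff_map_eq_zero]
      intro v hv
      rw [hAv] at hv
      obtain ⟨a1, a2⟩ := LinearIndependent.pair_iff.1 h2 _ _ hv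
      ext i
      fin_cases i
      · exact a1
      · exact a2
    exact ⟨(LinearEquiv.ofInjectiveEndo (A : EuclideanSpace ℝ (Fin 2) →ₗ[ℝ] EuclideanSpace ℝ (Fin 2))
      hinj).toContinuousLinearEquiv, h3, hAv⟩
  have h0 : c 0 ∈ Ioo (-δ) δ ×ˢ Ioo (-δ) δ := by
    rw [map_zero]; exact ⟨⟨by simpa, hδ⟩, ⟨by simpa, hδ⟩⟩
  obtain ⟨L0, hL0, -⟩ := hd 0 h0
  set h := (hsm 0 h0).toOpenPartialHomeomorph g hL0 (by simp) with hh
  have hsrc : (0 : EuclideanSpace ℝ (Fin 2)) ∈ h.source :=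
    (hsm 0 h0).mem_toOpenPartialHomeomorph_source hL0 (by simp)
  let d : ℝ × ℝ → EuclideanSpace ℝ (Fin 2) := fun q => !₂[q.1, q.2]
  have hdc : Continuous d := by fun_prop
  have hd0 : d 0 = 0 := by ext i; fin_cases i <;> rfl
  obtain ⟨ε, hε, hball⟩ := Metric.mem_nhds_iff.1 (hdc.continuousAt.preimage_mem_nhds
    (by rw [hd0]; exact h.open_source.mem_nhds hsrc))
  set r := min ε δ with hr
  have hr0 : 0 < r := lt_min hε hδ
  set R : Set (EuclideanSpace ℝ (Fin 2)) := {z | z 0 ∈ Ioo (-r) r ∧ z 1 ∈ Ioo (-r) r} with hR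
  have hRo : IsOpen R := by
    have : R = c ⁻¹' (Ioo (-r) r ×ˢ Ioo (-r) r) := rfl
    rw [this]
    exact (isOpen_Ioo.prod isOpen_Ioo).preimage c.continuous
  have hRδ : ∀ z ∈ R, c z ∈ Ioo (-δ) δ ×ˢ Ioo (-δ) δ := fun z hz => by
    have hsub : Ioo (-r) r ⊆ Ioo (-δ) δ := Ioo_subset_Ioo (neg_le_neg (min_le_right _ _)) (min_le_right _ _)
    exact ⟨hsub hz.1, hsub hz.2⟩
  have hRs : R ⊆ h.source := fun z hz => by
    have hsub : Ioo (-r) r ⊆ Ioo (-ε) ε := Ioo_subset_Ioo (neg_le_neg (min_le_left _ _)) (min_le_left _ _)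
    have h1 : d (c z) = z := by ext i; fin_cases i <;> rfl
    rw [← h1]
    refine hball ?_
    rw [← Prod.mk_zero_zero, ← ball_prod_same, Real.ball_eq_Ioo, zero_sub, zero_add]
    exact ⟨hsub hz.1, hsub hz.2⟩
  have hks : (h.restrOpen R hRo).source = R := by
    rw [OpenPartialHomeomorph.restrOpen_source, inter_eq_right.2 hRs]
  refine ⟨h.restrOpen R hRo, r, hr0, min_le_right _ _, hks, rfl, ?_, ?_, ?_⟩
  · rw [hks]
    exact fun z hz => (hsm z (hRδ z hz)).contDiffWithinAt
  · intro w hw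
    have hz : (h.restrOpen R hRo).symm w ∈ R := hks.subset ((h.restrOpen R hRo).map_target hw)
    obtain ⟨L, hL, -⟩ := hd _ (hRδ _ hz)
    exact ((h.restrOpen R hRo).contDiffAt_symm hw hL (hsm _ (hRδ _ hz))).contDiffWithinAt
  · intro z hz v
    rw [hks] at hz
    obtain ⟨L, hL, hLv⟩ := hd z (hRδ z hz)
    rw [← hLv, show ⇑(h.restrOpen R hRo) = g from rfl, hL.fderiv]
    rfl

/-- An adapted chart for a frame `e₁, e₂` with `[e₁, e₂] = -B e₂`. -/
theorem exists_adapted_chart {S : Type*} [TopologicalSpace S] [ChartedSpace (EuclideanSpace ℝ (Fin 2)) S]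
    [IsManifold (𝓡 2) ∞ S] {U : Set S} (hU : IsOpen U) {e₁ e₂ : (x : S) → TangentSpace (𝓡 2) x}
    (he₁ : ContMDiffOn (𝓡 2) (𝓡 2).tangent ∞ (fun x => (⟨x, e₁ x⟩ : TangentBundle (𝓡 2) S)) U)
    (he₂ : ContMDiffOn (𝓡 2) (𝓡 2).tangent ∞ (fun x => (⟨x, e₂ x⟩ : TangentBundle (𝓡 2) S)) U)
    (hli : ∀ x ∈ U, LinearIndependent ℝ ![e₁ x, e₂ x]) {B : S → ℝ} (hB : ContinuousOn B U)
    (hb : ∀ x ∈ U, mlieBracket (𝓡 2) e₁ e₂ x = -(B x • e₂ x)) {x₀ : S} (hx₀ : x₀ ∈ U) :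
    ∃ (φ : OpenPartialHomeomorph S (EuclideanSpace ℝ (Fin 2))) (δ : ℝ), 0 < δ ∧
      φ ∈ IsManifold.maximalAtlas (𝓡 2) ∞ S ∧ x₀ ∈ φ.source ∧ φ.source ⊆ U ∧
      φ.target = {z | z 0 ∈ Set.Ioo (-δ) δ ∧ z 1 ∈ Set.Ioo (-δ) δ} ∧
      ∀ z ∈ φ.target, ∀ v : EuclideanSpace ℝ (Fin 2), mfderiv (𝓡 2) (𝓡 2) φ.symm z v =
        v 0 • e₁ (φ.symm z) +
        (v 1 * Real.exp (∫ s in (0 : ℝ)..(z 0), B (φ.symm !₂[s, z 1]))) • e₂ (φ.symm z) := by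
  set ψ := chartAt (EuclideanSpace ℝ (Fin 2)) x₀ with hψ
  set Ω : Set (EuclideanSpace ℝ (Fin 2)) := ψ.target ∩ ψ.symm ⁻¹' U with hΩdef
  have hΩ : IsOpen Ω := ψ.isOpen_inter_preimage_symm hU
  set X := chartField x₀ e₁ with hXdef
  set Y := chartField x₀ e₂ with hYdef
  have hext : ∀ w ∈ ψ.target, extChartAt (𝓡 2) x₀ (ψ.symm w) = w := fun w hw => ψ.right_inv hw
  have hX : ContDiffOn ℝ ∞ X Ω := fun w hw => by
    have := contDiffAt_chartField (ψ.map_target hw.1) (he₁.contMDiffAt (hU.mem_nhds hw.2))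
    rw [hext w hw.1] at this
    exact this.contDiffWithinAt
  have hY : ContDiffOn ℝ ∞ Y Ω := fun w hw => by
    have := contDiffAt_chartField (ψ.map_target hw.1) (he₂.contMDiffAt (hU.mem_nhds hw.2))
    rw [hext w hw.1] at this
    exact this.contDiffWithinAt
  have hbc : ContinuousOn (fun w => B (ψ.symm w)) Ω :=
    hB.comp (ψ.continuousOn_symm.mono inter_subset_left) fun w hw => hw.2
  have hXY : ∀ w ∈ Ω, lieBracket ℝ X Y w = -(B (ψ.symm w) • Y w) := fun w hw => by
    have := mvfderiv_extChartAt_mlieBracket (ψ.map_target hw.1)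
      ((he₁.contMDiffAt (hU.mem_nhds hw.2)).mdifferentiableAt (by simp))
      ((he₂.contMDiffAt (hU.mem_nhds hw.2)).mdifferentiableAt (by simp))
    rw [hext w hw.1, hb _ hw.2, map_neg, map_smul] at this
    exact this
  have hsX : ∀ w ∈ ψ.target, mfderiv (𝓡 2) (𝓡 2) ψ.symm w (X w) = e₁ (ψ.symm w) := fun w hw =>
    mfderiv_chartAt_symm_chartField x₀ e₁ hw
  have hsY : ∀ w ∈ ψ.target, mfderiv (𝓡 2) (𝓡 2) ψ.symm w (Y w) = e₂ (ψ.symm w) := fun w hw =>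
    mfderiv_chartAt_symm_chartField x₀ e₂ hw
  have hψx : ψ x₀ ∈ Ω := ⟨ψ.map_source (mem_chart_source _ x₀), by
    rw [mem_preimage, ψ.left_inv (mem_chart_source _ x₀)]; exact hx₀⟩
  obtain ⟨G, δ, hδ, hG0, hG⟩ := exists_adapted_map hΩ hX hY hbc hXY hψx
  obtain ⟨h, r, hr, hrδ, hsrc, hcoe, hs, hs', hfd⟩ := exists_openPartialHomeomorph_of_rectangle hδ
    (fun q hq => ⟨(hG q hq).2.1, (hG q hq).2.2, by
      have hw := (hG q hq).1
      have := hli _ hw.2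
      rw [LinearIndependent.pair_iff] at this ⊢
      intro s t hst
      have h1 := congrArg (mfderiv (𝓡 2) (𝓡 2) ψ.symm (G q)) hst
      -- Pushed forward to `S`, the relation becomes one between `e₁` and `e₂`, with the second
      -- coefficient multiplied by a nonzero exponential.
      have h2 := this s (t * Real.exp (∫ r in (0 : ℝ)..q.1, B (ψ.symm (G (r, q.2))))) (by
        rw [← hsX _ hw.1, ← hsY _ hw.1]
        refine Eq.trans ?_ (h1.trans (map_zero _))
        refine Eq.trans ?_ (map_add _ _ _).symm
        refine congrArg₂ _ (map_smul _ _ _).symm ?_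
        rw [mul_smul]
        exact ((map_smul _ _ _).trans (congrArg _ (map_smul _ _ _))).symm)
      exact ⟨h2.1, (mul_eq_zero.1 h2.2).resolve_right (Real.exp_pos _).ne'⟩⟩)
  have hR : ∀ z ∈ h.source, (z 0, z 1) ∈ Ioo (-δ) δ ×ˢ Ioo (-δ) δ := fun z hz => by
    rw [hsrc] at hz
    have hsub : Ioo (-r) r ⊆ Ioo (-δ) δ := Ioo_subset_Ioo (neg_le_neg hrδ) hrδ
    exact ⟨hsub hz.1, hsub hz.2⟩
  have hz : ∀ z, h z = G (z 0, z 1) := fun z => congrFun hcoe z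
  have hΩz : ∀ z ∈ h.source, h z ∈ Ω := fun z hz' => by
    rw [hz]; exact (hG _ (hR z hz')).1
  set φ := ψ.trans h.symm with hφ
  have htgt : φ.target = h.source := by
    rw [hφ, OpenPartialHomeomorph.trans_target]
    exact inter_eq_left.2 fun z hz' => (hΩz z hz').1
  refine ⟨φ, r, hr, ?_, ?_, ?_, htgt.trans hsrc, ?_⟩
  · refine φ.mem_maximalAtlas_of_contMDiffOn ?_ ?_
    · refine ContMDiffOn.comp (t := h.target) (contMDiffOn_iff_contDiffOn.2 hs')
        (contMDiffOn_chart.mono ?_) ?_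
      · exact fun y hy => hy.1
      · exact fun y hy => hy.2
    · refine ContMDiffOn.comp (g := ψ.symm) (f := h) (t := ψ.target) (contMDiffOn_chart_symm (x := x₀))
        ((contMDiffOn_iff_contDiffOn.2 hs).mono htgt.subset) ?_
      exact fun z hz' => (hΩz z (htgt.subset hz')).1
  · refine ⟨mem_chart_source _ x₀, ?_⟩
    have h0 : (0 : EuclideanSpace ℝ (Fin 2)) ∈ h.source := by
      rw [hsrc]
      exact ⟨⟨by simpa, hr⟩, ⟨by simpa, hr⟩⟩
    have h1 : ψ x₀ = h 0 := by rw [hz]; exact hG0.symm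
    change ψ x₀ ∈ h.target
    rw [h1]
    exact h.map_source h0
  · intro y hy
    have h1 := hΩz _ (h.map_target hy.2)
    rw [h.right_inv hy.2] at h1
    have h2 : ψ.symm (ψ y) ∈ U := h1.2
    rwa [ψ.left_inv hy.1] at h2
  · intro z hz' v
    rw [htgt] at hz'
    have hw := hΩz z hz'
    have hd1 : MDifferentiableAt (𝓡 2) (𝓡 2) ψ.symm (h z) := mdifferentiableAt_atlas_symm (chart_mem_atlas _ _) hw.1
    have hd2 : DifferentiableAt ℝ h z :=
      (hs.contDiffAt (h.open_source.mem_nhds hz')).differentiableAt (by simp)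
    have hcomp := mfderiv_comp z hd1 hd2.mdifferentiableAt
    rw [show ⇑φ.symm = ψ.symm ∘ h from rfl, hcomp, mfderiv_eq_fderiv]
    refine (congrArg (mfderiv (𝓡 2) (𝓡 2) ψ.symm (h z)) (hfd z hz' v)).trans ?_
    refine (map_add _ _ _).trans ?_
    refine congrArg₂ _ ((map_smul _ _ _).trans (congrArg _ ?_)) ((map_smul _ _ _).trans ?_)
    · rw [← hz]
      exact hsX _ hw.1
    · refine (congrArg _ (map_smul _ _ _)).trans ?_
      rw [mul_smul, ← hz]
      refine congrArg _ (congrArg₂ _ ?_ (hsY _ hw.1))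
      refine congrArg _ (intervalIntegral.integral_congr fun s _ => ?_)
      simp only [Function.comp_apply, hz]
      rfl

/-! ### Coordinate differentials and partial derivatives -/

section
variable {S : Type*} [TopologicalSpace S] [ChartedSpace (EuclideanSpace ℝ (Fin 2)) S]
  {φ : OpenPartialHomeomorph S (EuclideanSpace ℝ (Fin 2))} {z : EuclideanSpace ℝ (Fin 2)}

theorem coordDiff_mfderiv_symm (hφ : φ ∈ IsManifold.maximalAtlas (𝓡 2) ∞ S) (hz : z ∈ φ.target) (i : Fin 2)
    (v : EuclideanSpace ℝ (Fin 2)) :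
    coordDiff φ i (φ.symm z) (mfderiv (𝓡 2) (𝓡 2) φ.symm z v) = v i := by
  let pr : EuclideanSpace ℝ (Fin 2) →L[ℝ] ℝ := EuclideanSpace.proj i
  have h1 : MDifferentiableAt (𝓡 2) (𝓡 2) φ.symm z :=
    (contMDiffAt_symm_of_mem_maximalAtlas hφ hz).mdifferentiableAt (by simp)
  have h2 : MDifferentiableAt (𝓡 2) (𝓡 2) φ (φ.symm z) :=
    (contMDiffAt_of_mem_maximalAtlas hφ (φ.map_target hz)).mdifferentiableAt (by simp)
  have h3 : MDifferentiableAt (𝓡 2) 𝓘(ℝ, ℝ) (fun q : S => φ q i) (φ.symm z) :=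
    pr.mdifferentiableAt.comp _ h2
  have h4 := mvfderiv_comp_apply z h3 h1 v
  refine h4.symm.trans ?_
  have h5 : (fun q : S => φ q i) ∘ φ.symm =ᶠ[𝓝 z] pr := by
    filter_upwards [φ.open_target.mem_nhds hz] with w hw
    rw [Function.comp_apply, φ.right_inv hw]
    rfl
  refine (mvfderiv_congr h5 _).trans ?_
  simp only [mvfderiv]
  rw [mfderiv_eq_fderiv, ContinuousLinearMap.fderiv]
  rfl

theorem partialU_eq_mvfderiv (hφ : φ ∈ IsManifold.maximalAtlas (𝓡 2) ∞ S) (hz : z ∈ φ.target) {h : S → ℝ}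
    (hh : MDifferentiableAt (𝓡 2) 𝓘(ℝ, ℝ) h (φ.symm z)) :
    partialU φ h z = mvfderiv (𝓡 2) h (φ.symm z) (coordField φ 0 z) := by
  have h1 : MDifferentiableAt (𝓡 2) (𝓡 2) φ.symm z :=
    (contMDiffAt_symm_of_mem_maximalAtlas hφ hz).mdifferentiableAt (by simp)
  have h2 : DifferentiableAt ℝ (h ∘ φ.symm) z := (hh.comp z h1).differentiableAt
  have h3 : HasDerivAt (fun s : ℝ => (!₂[s, z 1] : EuclideanSpace ℝ (Fin 2))) (EuclideanSpace.single 0 1) (z 0) := by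
    have h4 : (fun s : ℝ => (!₂[s, z 1] : EuclideanSpace ℝ (Fin 2))) = fun s =>
        s • EuclideanSpace.single 0 (1 : ℝ) + EuclideanSpace.single 1 (z 1) := by
      funext s
      ext i
      fin_cases i <;> simp
    rw [h4]
    simpa using ((hasDerivAt_id (z 0)).smul_const (EuclideanSpace.single (0 : Fin 2) (1 : ℝ))).add_const
      (EuclideanSpace.single 1 (z 1))
  have h5 : (!₂[z 0, z 1] : EuclideanSpace ℝ (Fin 2)) = z := by
    ext i
    fin_cases i <;> rfl
  rw [← h5] at h2
  have h6 := h2.hasFDerivAt.comp_hasDerivAt (z 0) h3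
  refine h6.deriv.trans ?_
  rw [h5]
  refine Eq.trans ?_ (mvfderiv_comp_apply z hh h1 _)
  simp only [mvfderiv]
  rw [mfderiv_eq_fderiv]
  rfl
end

end PASurface

/-! ### The main theorem -/

theorem mainTheorem3
    {M : Type*} [TopologicalSpace M] [ChartedSpace (EuclideanSpace ℝ (Fin 3)) M]
    [IsManifold (𝓡 3) ∞ M]
    [RiemannianBundle (fun y : M => TangentSpace (𝓡 3) y)]
    [IsContMDiffRiemannianBundle (𝓡 3) ∞ (EuclideanSpace ℝ (Fin 3))
      (fun y : M => TangentSpace (𝓡 3) y)]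
    {S : Type*} [TopologicalSpace S] [ChartedSpace (EuclideanSpace ℝ (Fin 2)) S]
    [IsManifold (𝓡 2) ∞ S]
    [RiemannianBundle (fun x : S => TangentSpace (𝓡 2) x)]
    [IsContMDiffRiemannianBundle (𝓡 2) ∞ (EuclideanSpace ℝ (Fin 2))
      (fun x : S => TangentSpace (𝓡 2) x)]
    -- the Levi-Civita connections of the ambient manifold and of the surface
    (covM : CovariantDerivative (𝓡 3) (EuclideanSpace ℝ (Fin 3))
      (fun y : M => TangentSpace (𝓡 3) y))
    (hcovM : PASurface.IsLeviCivita covM)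
    (covS : CovariantDerivative (𝓡 2) (EuclideanSpace ℝ (Fin 2))
      (fun x : S => TangentSpace (𝓡 2) x))
    (hcovS : PASurface.IsLeviCivita covS)
    -- the surface is a PA surface with `(V, θ)`, and `V` is anti-torqued with potential `f`
    (F : S → M) (N V : (x : S) → TangentSpace (𝓡 3) (F x)) (θ f : S → ℝ)
    (hPA : PASurface.IsPrescribedAngle (𝓡 3) (𝓡 2) F N V θ)
    (hV : PASurface.IsAntiTorquedAlong (𝓡 2) covM F V f)
    -- on the open set `U`, `θ` does not vanish and `e₁, e₂` is a smooth orthonormal frame of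
    -- principal directions with principal curvatures `κ₁, κ₂`
    (U : Set S) (hU : IsOpen U) (hθ : ∀ x ∈ U, θ x ≠ 0)
    (e₁ e₂ : (x : S) → TangentSpace (𝓡 2) x)
    (he₁ : ContMDiffOn (𝓡 2) (𝓡 2).tangent ∞ (fun x => (⟨x, e₁ x⟩ : TangentBundle (𝓡 2) S)) U)
    (he₂ : ContMDiffOn (𝓡 2) (𝓡 2).tangent ∞ (fun x => (⟨x, e₂ x⟩ : TangentBundle (𝓡 2) S)) U)
    (h₁₁ : ∀ x ∈ U, ‖e₁ x‖ = 1) (h₂₂ : ∀ x ∈ U, ‖e₂ x‖ = 1)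
    (h₁₂ : ∀ x ∈ U, inner ℝ (e₁ x) (e₂ x) = 0)
    (κ₁ κ₂ : S → ℝ)
    (hκ₁ : ∀ x ∈ U, PASurface.shapeOperator covM F N x (e₁ x) = κ₁ x • e₁ x)
    (hκ₂ : ∀ x ∈ U, PASurface.shapeOperator covM F N x (e₂ x) = κ₂ x • e₂ x)
    -- the tangential component of `V` is `sin θ e₁`
    (hT : ∀ x ∈ U, PASurface.tangentialPart (𝓡 3) (𝓡 2) F x (V x) = Real.sin (θ x) • e₁ x)
    (B : S → ℝ) (hB : ∀ x, B x = (f x + κ₂ x * Real.cos (θ x)) / Real.sin (θ x)) :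
    -- (i)
    (∀ x ∈ U, mvfderiv (𝓡 2) θ x (e₁ x) = κ₁ x + f x * Real.cos (θ x) ∧
      mvfderiv (𝓡 2) θ x (e₂ x) = 0) ∧
    -- (ii)
    (∀ x ∈ U, covS e₁ x (e₁ x) = 0 ∧ covS e₂ x (e₁ x) = 0 ∧
      covS e₁ x (e₂ x) = B x • e₂ x ∧ covS e₂ x (e₂ x) = -(B x • e₁ x) ∧
      VectorField.mlieBracket (𝓡 2) e₁ e₂ x = -(B x • e₂ x)) ∧
    -- (iii) and (iv): coordinates `(u, v)` near every point of `U`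
    ContMDiffOn (𝓡 2) 𝓘(ℝ, ℝ) ∞ B U ∧
    ∀ x₀ ∈ U, ∃ (φ : OpenPartialHomeomorph S (EuclideanSpace ℝ (Fin 2)))
      (a b c d u₀ : ℝ) (p : ℝ → ℝ),
      φ ∈ IsManifold.maximalAtlas (𝓡 2) ∞ S ∧ x₀ ∈ φ.source ∧ φ.source ⊆ U ∧
      φ.target = {z | z 0 ∈ Set.Ioo a b ∧ z 1 ∈ Set.Ioo c d} ∧ u₀ ∈ Set.Ioo a b ∧
      ContDiffOn ℝ ∞ p (Set.Ioo c d) ∧ (∀ v ∈ Set.Ioo c d, 0 < p v) ∧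
      ∀ z ∈ φ.target, ∀ β : ℝ,
        β = p (z 1) * Real.exp (∫ s in u₀..(z 0), B (φ.symm !₂[s, z 1])) →
        -- (iii) `g = du² + β² dv²`, `e₁ = ∂_u`, `e₂ = β⁻¹ ∂_v`
        (∀ X Y : TangentSpace (𝓡 2) (φ.symm z), inner ℝ X Y =
          PASurface.coordDiff φ 0 (φ.symm z) X * PASurface.coordDiff φ 0 (φ.symm z) Y +
          β ^ 2 * (PASurface.coordDiff φ 1 (φ.symm z) X *
            PASurface.coordDiff φ 1 (φ.symm z) Y)) ∧
        e₁ (φ.symm z) = PASurface.coordField φ 0 z ∧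
        e₂ (φ.symm z) = β⁻¹ • PASurface.coordField φ 1 z ∧
        -- (iv) the intrinsic and the extrinsic curvature
        (∀ X Y : TangentSpace (𝓡 2) (φ.symm z), LinearIndependent ℝ ![X, Y] →
          PASurface.sectionalCurvature covS (φ.symm z) X Y =
            -(PASurface.partialU φ B z + B (φ.symm z) ^ 2)) ∧
        LinearMap.det (PASurface.shapeOperator (J := 𝓡 2) covM F N (φ.symm z)) =
          (PASurface.partialU φ θ z - f (φ.symm z) * Real.cos (θ (φ.symm z))) *
            κ₂ (φ.symm z) := by
  have hfin : Module.finrank ℝ (EuclideanSpace ℝ (Fin 2)) = 2 := by simp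
  have hd₁ : ∀ x ∈ U, MDifferentiableAt (𝓡 2) (𝓡 2).tangent (fun x => (⟨x, e₁ x⟩ : TangentBundle (𝓡 2) S)) x :=
    fun x hx => (he₁.contMDiffAt (hU.mem_nhds hx)).mdifferentiableAt (by simp)
  have hd₂ : ∀ x ∈ U, MDifferentiableAt (𝓡 2) (𝓡 2).tangent (fun x => (⟨x, e₂ x⟩ : TangentBundle (𝓡 2) S)) x :=
    fun x hx => (he₂.contMDiffAt (hU.mem_nhds hx)).mdifferentiableAt (by simp)
  have e11 : ∀ x ∈ U, inner ℝ (e₁ x) (e₁ x) = 1 := fun x hx => by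
    rw [real_inner_self_eq_norm_sq, h₁₁ x hx]; norm_num
  have e22 : ∀ x ∈ U, inner ℝ (e₂ x) (e₂ x) = 1 := fun x hx => by
    rw [real_inner_self_eq_norm_sq, h₂₂ x hx]; norm_num
  have e21 : ∀ x ∈ U, inner ℝ (e₂ x) (e₁ x) = 0 := fun x hx => by rw [real_inner_comm, h₁₂ x hx]
  have hi : ∀ x ∈ U, mvfderiv (𝓡 2) θ x (e₁ x) = κ₁ x + f x * Real.cos (θ x) ∧
      mvfderiv (𝓡 2) θ x (e₂ x) = 0 := fun x hx => by
    have h := PASurface.mvfderiv_angle hcovM hPA hV (hθ x hx) (hT x hx)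
    rw [h, h, hκ₁ x hx, hκ₂ x hx, inner_smul_left, inner_smul_left, e11 x hx, e21 x hx]
    simp
  have hb : ∀ x ∈ U, VectorField.mlieBracket (𝓡 2) e₁ e₂ x = -(B x • e₂ x) := fun x hx => by
    rw [hB]
    exact PASurface.mlieBracket_frame hcovM hPA hV hfin hU hx (hθ x hx) (hd₁ x hx) (hd₂ x hx) h₁₁ h₂₂ h₁₂
      (hκ₁ x hx) (hκ₂ x hx) hT
  -- `B = -⟨[e₁, e₂], e₂⟩` on `U`, so smoothness of the frame and the metric suffices and none of
  -- `κ₂` is needed.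
  have hBs : ContMDiffOn (𝓡 2) 𝓘(ℝ, ℝ) ∞ B U := fun x hx => by
    have : IsManifold (𝓡 2) (minSmoothness ℝ 2) S := by
      rw [minSmoothness_of_isRCLikeNormedField]
      infer_instance
    have : IsManifold (𝓡 2) (((⊤ : ℕ∞) : WithTop ℕ∞) + 1) S := inferInstanceAs (IsManifold (𝓡 2) ∞ S)
    have h1 : ContMDiffAt (𝓡 2) (𝓡 2).tangent ∞
        (fun y => (⟨y, VectorField.mlieBracket (𝓡 2) e₁ e₂ y⟩ : TangentBundle (𝓡 2) S)) x := by
      refine ContMDiffAt.mlieBracket_vectorField (m := ⊤) (n := ⊤) (he₁.contMDiffAt (hU.mem_nhds hx))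
        (he₂.contMDiffAt (hU.mem_nhds hx)) ?_
      rw [minSmoothness_of_isRCLikeNormedField]
      exact le_rfl
    have h2 := (ContMDiffAt.inner_bundle (E := fun y : S => TangentSpace (𝓡 2) y) h1
      (he₂.contMDiffAt (hU.mem_nhds hx))).neg
    refine (h2.congr_of_eventuallyEq ?_).contMDiffWithinAt
    filter_upwards [hU.mem_nhds hx] with y hy
    rw [hb y hy, inner_neg_left, inner_smul_left, e22 y hy]
    simp
  refine ⟨hi, fun x hx => ?_, hBs, fun x₀ hx₀ => ?_⟩
  · have hc := PASurface.IsLeviCivita.cov_frame hcovS hfin hU hx (hd₁ x hx) (hd₂ x hx) h₁₁ h₂₂ h₁₂ (hb x hx)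
    have h1 := hc (e₁ x)
    have h2 := hc (e₂ x)
    rw [h₁₂ x hx, mul_zero, zero_smul, zero_smul, neg_zero] at h1
    rw [e22 x hx, mul_one] at h2
    exact ⟨h1.1, h1.2, h2.1, h2.2, hb x hx⟩
  have hli : ∀ x ∈ U, LinearIndependent ℝ ![e₁ x, e₂ x] := fun x hx => by
    rw [LinearIndependent.pair_iff]
    intro s t hst
    have h1 := congrArg (fun w => inner ℝ w (e₁ x)) hst
    have h2 := congrArg (fun w => inner ℝ w (e₂ x)) hst
    simp only [inner_add_left, inner_smul_left, e11 x hx, e22 x hx, e21 x hx, h₁₂ x hx, inner_zero_left] at h1 h2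
    exact ⟨by simpa using h1, by simpa using h2⟩
  obtain ⟨φ, δ, hδ, hφ, hxφ, hφU, htgt, hmf⟩ :=
    PASurface.exists_adapted_chart hU he₁ he₂ hli hBs.continuousOn hb hx₀
  -- On the line `u = 0` the coordinate `v` is flow time along the unit field `e₂`, so `β = 1`
  -- there: hence `u₀ = 0` and `p = 1`.
  refine ⟨φ, -δ, δ, -δ, δ, 0, fun _ => 1, hφ, hxφ, hφU, htgt, ⟨by linarith, hδ⟩, contDiffOn_const,
    fun _ _ => one_pos, fun z hz β hβ => ?_⟩
  rw [one_mul] at hβ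
  have hzU : φ.symm z ∈ U := hφU (φ.map_target hz)
  have hm := hmf z hz
  rw [← hβ] at hm
  have hβ0 : β ≠ 0 := by rw [hβ]; exact (Real.exp_pos _).ne'
  have hc0 : e₁ (φ.symm z) = PASurface.coordField φ 0 z := by
    rw [PASurface.coordField, hm]; simp
  have hc1 : PASurface.coordField φ 1 z = β • e₂ (φ.symm z) := by
    rw [PASurface.coordField, hm]; simp
  have hBd : MDifferentiableAt (𝓡 2) 𝓘(ℝ, ℝ) B (φ.symm z) :=
    (hBs.contMDiffAt (hU.mem_nhds hzU)).mdifferentiableAt (by simp)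
  have hθd : MDifferentiableAt (𝓡 2) 𝓘(ℝ, ℝ) θ (φ.symm z) := hPA.angle_smooth.contMDiffAt.mdifferentiableAt (by simp)
  have hE : Module.finrank ℝ (TangentSpace (𝓡 2) (φ.symm z)) = 2 := hfin
  refine ⟨fun X Y => ?_, hc0, by rw [hc1, inv_smul_smul₀ hβ0], fun X Y hXY => ?_, ?_⟩
  · have hcd : ∀ W : TangentSpace (𝓡 2) (φ.symm z),
        PASurface.coordDiff φ 0 (φ.symm z) W = inner ℝ W (e₁ (φ.symm z)) ∧
        β * PASurface.coordDiff φ 1 (φ.symm z) W = inner ℝ W (e₂ (φ.symm z)) := by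
      intro W
      have hW := PASurface.eq_smul_add_smul_of_orthonormal hE (h₁₁ _ hzU) (h₂₂ _ hzU) (h₁₂ _ hzU) W
      -- Since `∂_u = e₁` and `∂_v = β e₂`, the coordinate components of `W` are its frame
      -- components, the second divided by `β`; `du` and `dv` are read off from them.
      have hW' : W = mfderiv (𝓡 2) (𝓡 2) φ.symm z
          (!₂[inner ℝ W (e₁ (φ.symm z)), β⁻¹ * inner ℝ W (e₂ (φ.symm z))] : EuclideanSpace ℝ (Fin 2)) := by
        refine hW.trans ((hm _).trans ?_).symm
        simp [mul_comm, hβ0]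
      have h0 := PASurface.coordDiff_mfderiv_symm hφ hz 0
        !₂[inner ℝ W (e₁ (φ.symm z)), β⁻¹ * inner ℝ W (e₂ (φ.symm z))]
      have h1 := PASurface.coordDiff_mfderiv_symm hφ hz 1
        !₂[inner ℝ W (e₁ (φ.symm z)), β⁻¹ * inner ℝ W (e₂ (φ.symm z))]
      rw [← hW'] at h0 h1
      rw [h0, h1]
      simp [hβ0]
    have hY := PASurface.eq_smul_add_smul_of_orthonormal hE (h₁₁ _ hzU) (h₂₂ _ hzU) (h₁₂ _ hzU) Y
    have hXY : inner ℝ X Y = inner ℝ X (e₁ (φ.symm z)) * inner ℝ Y (e₁ (φ.symm z)) +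
        inner ℝ X (e₂ (φ.symm z)) * inner ℝ Y (e₂ (φ.symm z)) := by
      conv_lhs => rw [hY]
      rw [inner_add_right, inner_smul_right, inner_smul_right]
      ring
    rw [hXY, ← (hcd X).1, ← (hcd Y).1, ← (hcd X).2, ← (hcd Y).2]
    ring
  · rw [PASurface.IsLeviCivita.sectionalCurvature_frame hcovS hfin hU hzU he₁ he₂ h₁₁ h₂₂ h₁₂ hBd hb hXY,
      PASurface.partialU_eq_mvfderiv hφ hz hBd, ← hc0]
  -- The determinant is `κ₁ κ₂`, and (i) with `e₁ = ∂_u` gives `κ₁ = ∂θ/∂u - f cos θ`.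
  · rw [PASurface.det_eq_mul_of_orthonormal hE (h₁₁ _ hzU) (h₂₂ _ hzU) (h₁₂ _ hzU) (hκ₁ _ hzU) (hκ₂ _ hzU),
      PASurface.partialU_eq_mvfderiv hφ hz hθd, ← hc0, (hi _ hzU).1]
    ring
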